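/- Let $Y_\ell^m(\theta,\phi)=\sqrt{\tfrac{2\ell+1}{4\pi}\tfrac{(\ell-m)!}{(\ell+m)!}}\,P_\ell^m(\cos\theta)\,e^{im\phi}$ be the orthonormal spherical harmonics on the unit sphere $\mathbb S^2$ with its area measure $ds=\sin\theta\,d\theta\,d\phi$, where $P_\ell^m(t)=\frac{(-1)^m}{2^\ell\ell!}(1-t^2)^{m/2}\frac{d^{\ell+m}}{dt^{\ell+m}}(t^2-1)^\ell$ and $P_\ell^{-m}=(-1)^m\frac{(\ell-m)!}{(\ell+m)!}P_\ell^m$ for $0\le m\le\ell$. Index them by the single integer $n=\ell^2+\ell+m$, write $(\ell,m)\leftrightarrow n$ and $Y_n=Y_\ell^m$, and let $(f)_n=(f)_\ell^m=\langle f,Y_n\rangle=\int_{\mathbb S^2}f\,\overline{Y_n}\,ds$ for $f\in L^2(\mathbb S^2)$. A function $f\in L^2(\mathbb S^2)$ is band-limited with maximum degree $L$ if $(f)_\ell^m=0$ for all $\ell>L$. The spherical convolution is $(g\circledast\zeta)(y)=\sum_{n}(g)_n(\zeta)_nY_n(y)$. Let $h\in L^2(\mathbb S^2)$ be an azimuthally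 symmetric window (a function of the co-latitude $\theta$ only) with $\|h\|=1$ that is band-limited with maximum degree $L_h$, and put $N_h=L_h^2+2L_h$. For $y\in\mathbb S^2$ with co-latitude $\vartheta$ and longitude $\varphi$ let $\mathcal D(y)h$ be $h$ rotated by $\vartheta$ about the $y$-axis and then by $\varphi$ about the $z$-axis. The SLSHT (spatially localized spherical harmonic transform) distribution of a signal $f\in L^2(\mathbb S^2)$ has the components $$g_f(y;n)=\int_{\mathbb S^2}(\mathcal D(y)h)(x)\,f(x)\,\overline{Y_n(x)}\,ds(x),\qquad n=0,1,2,\dots$$ Let the observation be $f=s+z$, where the signal $s$ and the noise $z$ are zero-mean, possibly anisotropic, complex random processes on the sphere with realisations in $L^2(\mathbb S^2)$ and finite expected energy $\mathbb E\|s\|^2,\ \mathbb E\|z\|^2<\infty$, which are uncorrelated: $\mathbb E\{(s)_n\overline{(z)_r}\}=0$ for all $n,r$. Let $\mathbf C_S^{nr}=\mathbb E\{(s)_n\overline{(s)_r}\}$ and $\mathbf C_Z^{nr}=\mathbb E\{(z)_n\overline{(z)_r}\}$ be their spectral covariance matrices. A filter is a sequence $\zeta=(\zeta(\cdot;n))_{n\ge0}$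 of functions in $L^2(\mathbb S^2)$ that are band-limited with maximum degree $L_h$; write $(\zeta_n)_r=\langle\zeta(\cdot;n),Y_r\rangle$. Its spatio-spectral mean-square error is $$\mathcal E_{ss}(\zeta)=\mathbb E\Big\{\sum_{n=0}^\infty\big\|g_f(\cdot;n)\circledast\zeta(\cdot;n)-g_s(\cdot;n)\big\|^2\Big\}.$$ Let $T(c;r;n)=\int_{\mathbb S^2}Y_r\,Y_c\,\overline{Y_n}\,ds$ and, for $(p,q)\leftrightarrow r$, $$H(c;r;n)=(-1)^q\sqrt{\frac{4\pi}{2p+1}}\;(h)_p^0\;T(c;p,-q;n),$$ where $T(c;p,-q;n)=T(c;r';n)$ with $(p,-q)\leftrightarrow r'$. Then the filter with the coefficients $$(\zeta_n)_r=\frac{\sum_{c=0}^\infty\sum_{c'=0}^\infty H(c;r;n)\,H(c';r;n)\,\mathbf C_S^{cc'}}{\sum_{c=0}^\infty\sum_{c'=0}^\infty H(c;r;n)\,H(c';r;n)\,\big(\mathbf C_S^{cc'}+\mathbf C_Z^{cc'}\big)},\qquad n\ge0,\ 0\le r\le N_h,$$ wherever the denominator is non-zero, and $(\zeta_n)_r=0$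 where the denominator vanishes, exists and minimises $\mathcal E_{ss}$ among all filters. Conversely, every filter that minimises $\mathcal E_{ss}$ has these coefficients $(\zeta_n)_r$ for all $n\ge0$ and $0\le r\le N_h$ at which the denominator is non-zero. -/

import Mathlib

open MeasureTheory
open scoped ENNReal ComplexConjugate

noncomputable section

namespace SLSHT

/-! ### The unit sphere, its area measure and spherical coordinates -/

/-- The unit sphere in Euclidean three-space. -/
abbrev S2 : Type := Metric.sphere (0 : EuclideanSpace ℝ (Fin 3)) 1

/-- The surface area measure `sin θ dθ dφ` on the sphere (of total mass `4π`). -/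
def area : Measure S2 := (volume : Measure (EuclideanSpace ℝ (Fin 3))).toSphere

/-- The co-latitude `θ ∈ [0, π]`. -/
def colatitude (x : S2) : ℝ := Real.arccos (x.1 2)

/-- The longitude `φ`, determined modulo `2π`; by convention it is `0` at the two poles. -/
def longitude (x : S2) : ℝ := Complex.arg ⟨x.1 0, x.1 1⟩

/-! ### Spherical harmonics -/

/-- The associated Legendre function of degree `l` and order `m ≥ 0`, with the
Condon-Shortley phase. -/
def legendreNonneg (l m : ℕ) (t : ℝ) : ℝ :=
  (-1) ^ m / (2 ^ l * (l.factorial : ℝ)) * Real.sqrt (1 - t ^ 2) ^ m *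
    ((Polynomial.derivative^[l + m] ((Polynomial.X ^ 2 - 1) ^ l : Polynomial ℝ)).eval t)

/-- The associated Legendre function of degree `l` and order `-l ≤ m ≤ l`. -/
def legendre (l : ℕ) (m : ℤ) (t : ℝ) : ℝ :=
  if 0 ≤ m then legendreNonneg l m.natAbs t
  else (-1) ^ m.natAbs * (((l - m.natAbs).factorial : ℝ) / ((l + m.natAbs).factorial : ℝ)) *
    legendreNonneg l m.natAbs t

/-- The normalisation factor of the spherical harmonic of degree `l` and order `m`. -/
def normFactor (l : ℕ) (m : ℤ) : ℝ :=
  Real.sqrt ((2 * l + 1) / (4 * Real.pi) *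
    (((l - m).toNat.factorial : ℝ) / ((l + m).toNat.factorial : ℝ)))

/-- The spherical harmonic of degree `l` and order `m`. -/
def sphHarm (l : ℕ) (m : ℤ) (x : S2) : ℂ :=
  ((normFactor l m * legendre l m (Real.cos (colatitude x)) : ℝ) : ℂ) *
    Complex.exp (Complex.I * m * longitude x)

/-- The degree `l = ⌊√n⌋` of the single index `n = l² + l + m`. -/
def deg (n : ℕ) : ℕ := Nat.sqrt n

/-- The order `m = n - l (l + 1)` of the single index `n = l² + l + m`. -/
def ord (n : ℕ) : ℤ := (n : ℤ) - (deg n : ℤ) * ((deg n : ℤ) + 1)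

/-- The single index `l² + l + m` of the pair `(l, m)`, for `-l ≤ m ≤ l`. -/
def idx (l : ℕ) (m : ℤ) : ℕ := ((l : ℤ) ^ 2 + l + m).toNat

/-- The spherical harmonics with the single index. -/
def Y (n : ℕ) (x : S2) : ℂ := sphHarm (deg n) (ord n) x

/-- The spherical harmonic coefficient `⟨f, Y_n⟩`. -/
def coeff (f : S2 → ℂ) (n : ℕ) : ℂ := ∫ x, f x * conj (Y n x) ∂area

/-- `f` is square integrable and band-limited with maximum spectral degree `L`. -/
def IsBandLimited (L : ℕ) (f : S2 → ℂ) : Prop :=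
  MemLp f 2 area ∧ ∀ n, L < deg n → coeff f n = 0

/-- The spherical harmonic triple product. -/
def T (c r n : ℕ) : ℂ := ∫ x, Y r x * Y c x * conj (Y n x) ∂area

/-- Spherical convolution, defined as multiplication of the harmonic coefficients. -/
def conv (h f : S2 → ℂ) (y : S2) : ℂ := ∑' n, coeff h n * coeff f n * Y n y

/-! ### Rotations -/

lemma norm_sq_coord (x : S2) : x.1 0 ^ 2 + x.1 1 ^ 2 + x.1 2 ^ 2 = 1 := by
  have h := EuclideanSpace.norm_sq_eq x.1
  have hx : ‖x.1‖ = 1 := by simp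
  rw [hx, Fin.sum_univ_three] at h
  simp only [Real.norm_eq_abs, sq_abs] at h
  linarith

lemma mem_sphere_of_sq {a b c : ℝ} (h : a ^ 2 + b ^ 2 + c ^ 2 = 1) :
    !₂[a, b, c] ∈ Metric.sphere (0 : EuclideanSpace ℝ (Fin 3)) 1 := by
  rw [mem_sphere_zero_iff_norm, EuclideanSpace.norm_eq, Fin.sum_univ_three]
  simp [h]

/-- Rotation of the sphere by the angle `a` about the `z`-axis. -/
def rotZ (a : ℝ) (x : S2) : S2 :=
  ⟨!₂[Real.cos a * x.1 0 - Real.sin a * x.1 1, Real.sin a * x.1 0 + Real.cos a * x.1 1, x.1 2],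
    mem_sphere_of_sq (by
      linear_combination norm_sq_coord x + (x.1 0 ^ 2 + x.1 1 ^ 2) * Real.sin_sq_add_cos_sq a)⟩

/-- Rotation of the sphere by the angle `a` about the `y`-axis. -/
def rotY (a : ℝ) (x : S2) : S2 :=
  ⟨!₂[Real.cos a * x.1 0 + Real.sin a * x.1 2, x.1 1, -Real.sin a * x.1 0 + Real.cos a * x.1 2],
    mem_sphere_of_sq (by
      linear_combination norm_sq_coord x + (x.1 0 ^ 2 + x.1 2 ^ 2) * Real.sin_sq_add_cos_sq a)⟩

/-- The rotation operator `𝓓(y)`, for `y` with co-latitude `ϑ` and longitude `φ`: the function is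
rotated by `ϑ` about the `y`-axis, then by `φ` about the `z`-axis. So `(𝓓(y) h)(x) = h(R⁻¹ x)`
where `R = R_z(φ) R_y(ϑ)`. -/
def rotate (y : S2) (h : S2 → ℂ) (x : S2) : ℂ :=
  h (rotY (-colatitude y) (rotZ (-longitude y) x))

/-! ### Windows, the SLSHT distribution and filters -/

/-- An azimuthally symmetric window of unit energy, band-limited with maximum degree `L`. -/
structure IsWindow (L : ℕ) (h : S2 → ℂ) : Prop where
  bandLimited : IsBandLimited L h
  symmetric : ∀ x x' : S2, colatitude x = colatitude x' → h x = h x'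
  unit_energy : ∫ x, ‖h x‖ ^ 2 ∂area = 1

/-- The component `g_f(y; n)` of the SLSHT distribution of `f` with window `h`. -/
def slsht (h f : S2 → ℂ) (n : ℕ) (y : S2) : ℂ :=
  ∫ x, rotate y h x * f x * conj (Y n x) ∂area

/-- A filter function `ζ(·; n)`, `n = 0, 1, 2, …`, whose components are all band-limited with
maximum degree `L`. -/
def IsFilter (L : ℕ) (ζ : ℕ → S2 → ℂ) : Prop := ∀ n, IsBandLimited L (ζ n)

/-- The filtered distribution `v(y; n)` for the input `f`. -/
def filtered (h f : S2 → ℂ) (ζ : ℕ → S2 → ℂ) (n : ℕ) : S2 → ℂ := conv (slsht h f n) (ζ n)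

/-- The quantity `H(c; r; n)`, where `(p, q) ↔ r`. -/
def H (h : S2 → ℂ) (c r n : ℕ) : ℂ :=
  (-1) ^ (ord r).natAbs * (Real.sqrt (4 * Real.pi / (2 * deg r + 1)) : ℂ) *
    coeff h (idx (deg r) 0) * T c (idx (deg r) (-ord r)) n

/-! ### Random processes on the sphere -/

section RandomField

variable {Ω : Type*} [MeasurableSpace Ω]

/-- A zero-mean random process on the sphere with finite expected energy: almost all realisations
are signals in `L²`, the spectral coefficients are random variables of mean zero. It may be
anisotropic, and it need not be Gaussian. -/
structure IsZeroMeanProcess (P : Measure Ω) (s : Ω → S2 → ℂ) : Prop where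
  memLp : ∀ᵐ ω ∂P, MemLp (s ω) 2 area
  aestronglyMeasurable_coeff : ∀ n, AEStronglyMeasurable (fun ω => coeff (s ω) n) P
  finite_energy : ∫⁻ ω, ∫⁻ x, ‖s ω x‖ₑ ^ 2 ∂area ∂P < ∞
  mean_zero : ∀ n, ∫ ω, coeff (s ω) n ∂P = 0

/-- The spectral covariance matrix of a zero-mean process. -/
def specCov (P : Measure Ω) (s : Ω → S2 → ℂ) (n r : ℕ) : ℂ :=
  ∫ ω, coeff (s ω) n * conj (coeff (s ω) r) ∂P

/-- The two processes are uncorrelated. -/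
def Uncorrelated (P : Measure Ω) (s z : Ω → S2 → ℂ) : Prop :=
  ∀ n r, ∫ ω, coeff (s ω) n * conj (coeff (z ω) r) ∂P = 0

/-- The spatio-spectral mean-square error between the filtered distribution of the
input `f` and the SLSHT distribution of the signal `s`. -/
def mse (P : Measure Ω) (h : S2 → ℂ) (f s : Ω → S2 → ℂ) (ζ : ℕ → S2 → ℂ) : ℝ≥0∞ :=
  ∫⁻ ω, ∑' n, ∫⁻ y, ‖filtered h (f ω) ζ n y - slsht h (s ω) n y‖ₑ ^ 2 ∂area ∂P

/-- The filter `ζ` minimises the spatio-spectral mean-square error among all filters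
band-limited with maximum degree `L`. -/
def IsOptimalFilter (P : Measure Ω) (L : ℕ) (h : S2 → ℂ) (f s : Ω → S2 → ℂ)
    (ζ : ℕ → S2 → ℂ) : Prop :=
  IsFilter L ζ ∧ ∀ ξ, IsFilter L ξ → mse P h f s ζ ≤ mse P h f s ξ

end RandomField

/-- The double sum of `H(c; r; n) H(c'; r; n) C^{cc'}` over all `c` and `c'`. -/
def quadSum (h : S2 → ℂ) (C : ℕ → ℕ → ℂ) (r n : ℕ) : ℂ :=
  ∑' c, ∑' c', H h c r n * H h c' r n * C c c'

end SLSHT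

end

/-!
By the addition theorem the rotated window `𝒟(y)h` expands in the `Y_r` with coefficients
proportional to `conj (Y_r(y))`. Hence `g_f(·; n)` is band-limited with maximum degree `L_h`, and
its coefficient at `(p, q) ↔ r` is a constant multiple of `⟨Y_p^{-q} f, Y_n⟩`, which equals
`∑ c, H(c; r; n) (f)_c`. Parseval's identity turns the mean-square error into the sum over
`(n, r)` of the scalar Wiener problems `‖w - 1‖² a + ‖w‖² b` in `w = (ζ_n)_r`, with `a` and `b` the
quadratic forms of the signal and noise covariances; the cross terms vanish because signal and
noise are uncorrelated. Each is minimised exactly at `w = a / (a + b)` unless `a + b = 0`. The zero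
filter has finite error, so a strict improvement in one term is a strict improvement of the total.
-/

noncomputable section

namespace SLSHT

/-! ### Rodrigues polynomials -/

section Rodrigues

open Polynomial

lemma intervalIntegrable_eval (p : ℝ[X]) (a b : ℝ) :
    IntervalIntegrable (fun t => p.eval t) volume a b :=
  p.continuous.intervalIntegrable a b

lemma integral_eval_derivative (p : ℝ[X]) (a b : ℝ) :
    ∫ t in a..b, (derivative p).eval t = p.eval b - p.eval a :=
  intervalIntegral.integral_eq_sub_of_hasDerivAt (fun t _ => p.hasDerivAt t)
    (intervalIntegrable_eval _ _ _)

lemma integral_derivative_mul (p q : ℝ[X]) (a b : ℝ) :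
    ∫ t in a..b, (derivative p * q).eval t =
      (p * q).eval b - (p * q).eval a - ∫ t in a..b, (p * derivative q).eval t := by
  rw [← integral_eval_derivative, derivative_mul, ← intervalIntegral.integral_sub
    (intervalIntegrable_eval _ _ _) (intervalIntegrable_eval _ _ _)]
  simp only [eval_add, add_sub_cancel_right]

lemma integral_iterate_derivative_mul (N : ℕ) (p q : ℝ[X]) (a b : ℝ)
    (ha : ∀ i j, i + j + 1 = N → (derivative^[j] p * derivative^[i] q).eval a = 0)
    (hb : ∀ i j, i + j + 1 = N → (derivative^[j] p * derivative^[i] q).eval b = 0) :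
    ∫ t in a..b, (derivative^[N] p * q).eval t =
      (-1) ^ N * ∫ t in a..b, (p * derivative^[N] q).eval t := by
  induction N generalizing q with
  | zero => simp
  | succ N ih =>
    have boundary_a : (derivative^[N] p * q).eval a = 0 := ha 0 N (by omega)
    have boundary_b : (derivative^[N] p * q).eval b = 0 := hb 0 N (by omega)
    rw [Function.iterate_succ_apply', integral_derivative_mul, boundary_a, boundary_b,
      ih (derivative q) (fun i j hij => ha (i + 1) j (by omega))
        (fun i j hij => hb (i + 1) j (by omega)), Function.iterate_succ_apply, pow_succ]
    ring

lemma iterate_derivative_eq_C {R : Type*} [Semiring R] {N : ℕ} {q : R[X]}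
    (h : q.natDegree ≤ N) : derivative^[N] q = C (N.factorial • q.coeff N) := by
  ext k
  rw [coeff_iterate_derivative, coeff_C]
  split_ifs with hk
  · simp [hk, Nat.descFactorial_self]
  · rw [coeff_eq_zero_of_natDegree_lt (by omega), smul_zero]

lemma natDegree_sq_sub_one_pow {R : Type*} [CommRing R] [Nontrivial R] (l : ℕ) :
    ((X ^ 2 - 1 : R[X]) ^ l).natDegree = 2 * l := by
  rw [← C_1, (monic_X_pow_sub_C _ two_ne_zero).natDegree_pow, natDegree_X_pow_sub_C, mul_comm]

lemma coeff_sq_sub_one_pow {R : Type*} [CommRing R] [Nontrivial R] (l : ℕ) :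
    ((X ^ 2 - 1 : R[X]) ^ l).coeff (2 * l) = 1 := by
  rw [← natDegree_sq_sub_one_pow (R := R), ← C_1]
  exact ((monic_X_pow_sub_C _ two_ne_zero).pow l).coeff_natDegree

lemma derivative_X_mul_sq_sub_one_pow {R : Type*} [CommRing R] (l : ℕ) :
    derivative (X * (X ^ 2 - 1 : R[X]) ^ (l + 1)) =
      C (2 * l + 3 : R) * (X ^ 2 - 1) ^ (l + 1) + C (2 * l + 2 : R) * (X ^ 2 - 1) ^ l := by
  simp only [derivative_mul, derivative_X, derivative_pow, derivative_sub, derivative_one,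
    map_add, map_mul, map_natCast, map_one, map_ofNat, Nat.cast_add, Nat.cast_one,
    add_tsub_cancel_right, Nat.cast_ofNat]
  ring

lemma integral_sq_sub_one_pow_succ (l : ℕ) :
    (2 * l + 3) * ∫ t in (-1 : ℝ)..1, ((X ^ 2 - 1 : ℝ[X]) ^ (l + 1)).eval t =
      -(2 * l + 2) * ∫ t in (-1 : ℝ)..1, ((X ^ 2 - 1 : ℝ[X]) ^ l).eval t := by
  have boundary := integral_eval_derivative (X * (X ^ 2 - 1 : ℝ[X]) ^ (l + 1)) (-1) 1
  have vanish {t : ℝ} (ht : t ^ 2 = 1) : eval t (X * (X ^ 2 - 1) ^ (l + 1)) = 0 := by simp [ht]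
  rw [vanish (by norm_num), vanish (by norm_num), derivative_X_mul_sq_sub_one_pow] at boundary
  simp only [eval_add, eval_mul, eval_C] at boundary
  rw [intervalIntegral.integral_add ((intervalIntegrable_eval _ _ _).const_mul _)
    ((intervalIntegrable_eval _ _ _).const_mul _), intervalIntegral.integral_const_mul,
    intervalIntegral.integral_const_mul] at boundary
  linarith

lemma integral_sq_sub_one_pow (l : ℕ) :
    ∫ t in (-1 : ℝ)..1, ((X ^ 2 - 1 : ℝ[X]) ^ l).eval t =
      (-1) ^ l * (2 ^ (2 * l + 1) * (l.factorial : ℝ) ^ 2 / (2 * l + 1).factorial) := by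
  induction l with
  | zero => norm_num
  | succ l ih =>
    apply mul_left_cancel₀ (show (2 * l + 3 : ℝ) ≠ 0 by positivity)
    rw [integral_sq_sub_one_pow_succ, ih, show 2 * (l + 1) + 1 = 2 * l + 1 + 1 + 1 by ring,
      Nat.factorial_succ (2 * l + 1 + 1), Nat.factorial_succ (2 * l + 1), Nat.factorial_succ l]
    push_cast
    field_simp
    ring

/-- The polynomial `D^(l+m) (X² - 1)^l` of Rodrigues' formula for the associated Legendre
functions. -/
def rodrigues (l m : ℕ) : ℝ[X] := derivative^[l + m] ((X ^ 2 - 1) ^ l)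

lemma natDegree_rodrigues_le (l m : ℕ) : (rodrigues l m).natDegree ≤ l - m := by
  refine (natDegree_iterate_derivative _ _).trans ?_
  rw [natDegree_sq_sub_one_pow]
  omega

lemma coeff_rodrigues {l m : ℕ} (h : m ≤ l) :
    (rodrigues l m).coeff (l - m) = (2 * l).factorial / (l - m).factorial := by
  have hfact : (l - m).factorial * (2 * l).descFactorial (l + m) = (2 * l).factorial := by
    rw [← Nat.factorial_mul_descFactorial (show l + m ≤ 2 * l by omega),
      show 2 * l - (l + m) = l - m by omega]
  rw [rodrigues, coeff_iterate_derivative, show l - m + (l + m) = 2 * l by omega,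
    coeff_sq_sub_one_pow, nsmul_eq_mul, mul_one, eq_div_iff (by positivity), mul_comm]
  exact_mod_cast hfact

lemma eval_iterate_derivative_eq_zero_of_dvd {R : Type*} [CommRing R] {p : R[X]} {k j : ℕ}
    (hp : (X ^ 2 - 1 : R[X]) ^ k ∣ p) (hj : j < k) {t : R} (ht : t ^ 2 = 1) :
    (derivative^[j] p).eval t = 0 := by
  obtain ⟨c, hc⟩ : (X ^ 2 - 1 : R[X]) ∣ derivative^[j] p :=
    (dvd_pow_self _ (by omega)).trans (pow_sub_dvd_iterate_derivative_of_pow_dvd j hp)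
  simp [hc, ht]

/-- Integrating by parts `l + m` times moves all derivatives onto a polynomial of degree at most
`l + m`, of which only the leading coefficient survives. -/
lemma integral_rodrigues_mul_eq_coeff {l m : ℕ} {q : ℝ[X]} (hdvd : (X ^ 2 - 1) ^ m ∣ q)
    (hdeg : q.natDegree ≤ l + m) :
    ∫ t in (-1 : ℝ)..1, (rodrigues l m * q).eval t =
      (-1) ^ m * (2 ^ (2 * l + 1) * (l.factorial : ℝ) ^ 2 / (2 * l + 1).factorial) *
        ((l + m).factorial * q.coeff (l + m)) := by
  have boundary (t : ℝ) (ht : t ^ 2 = 1) (i j : ℕ) (hij : i + j + 1 = l + m) :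
      (derivative^[j] ((X ^ 2 - 1 : ℝ[X]) ^ l) * derivative^[i] q).eval t = 0 := by
    rw [eval_mul]
    by_cases hi : i < m
    · rw [eval_iterate_derivative_eq_zero_of_dvd hdvd hi ht, mul_zero]
    · rw [eval_iterate_derivative_eq_zero_of_dvd dvd_rfl (show j < l by omega) ht, zero_mul]
  have hsign : (-1 : ℝ) ^ (l + m) * (-1) ^ l = (-1) ^ m := by
    rw [pow_add, mul_right_comm, ← mul_pow, neg_one_mul, neg_neg, one_pow, one_mul]
  rw [rodrigues, integral_iterate_derivative_mul _ _ _ _ _ (boundary _ (by norm_num))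
    (boundary _ (by norm_num)), iterate_derivative_eq_C hdeg]
  simp only [eval_mul, eval_C, nsmul_eq_mul]
  rw [intervalIntegral.integral_mul_const, integral_sq_sub_one_pow, ← hsign]
  ring

lemma natDegree_sq_sub_one_pow_mul_rodrigues_le {l m : ℕ} (hm : m ≤ l) :
    ((X ^ 2 - 1) ^ m * rodrigues l m).natDegree ≤ l + m := by
  refine natDegree_mul_le.trans ?_
  have := natDegree_rodrigues_le l m
  rw [natDegree_sq_sub_one_pow]
  omega

lemma integral_rodrigues_mul_of_lt {l l' m : ℕ} (hl : l' < l) (hm : m ≤ l') :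
    ∫ t in (-1 : ℝ)..1, (rodrigues l m * ((X ^ 2 - 1) ^ m * rodrigues l' m)).eval t = 0 := by
  have hdeg := natDegree_sq_sub_one_pow_mul_rodrigues_le hm
  rw [integral_rodrigues_mul_eq_coeff (dvd_mul_right _ _) (by omega),
    coeff_eq_zero_of_natDegree_lt (by omega), mul_zero, mul_zero]

lemma integral_rodrigues_mul_self {l m : ℕ} (hm : m ≤ l) :
    ∫ t in (-1 : ℝ)..1, (rodrigues l m * ((X ^ 2 - 1) ^ m * rodrigues l m)).eval t =
      (-1 : ℝ) ^ m * (2 * (2 ^ l * l.factorial) ^ 2 / (2 * l + 1)) *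
        ((l + m).factorial / (l - m).factorial) := by
  have hcoeff : ((X ^ 2 - 1) ^ m * rodrigues l m).coeff (l + m) =
      ((2 * l).factorial / (l - m).factorial : ℝ) := by
    rw [show l + m = 2 * m + (l - m) by omega, coeff_mul_add_eq_of_natDegree_le
      (natDegree_sq_sub_one_pow m).le (natDegree_rodrigues_le l m), coeff_sq_sub_one_pow,
      coeff_rodrigues hm, one_mul]
  rw [integral_rodrigues_mul_eq_coeff (dvd_mul_right _ _)
    (natDegree_sq_sub_one_pow_mul_rodrigues_le hm), hcoeff, Nat.factorial_succ (2 * l)]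
  push_cast
  field_simp
  ring

end Rodrigues

/-! ### Integration over spheres -/

section SphereMeasure

open Set
open scoped Pointwise

variable {E : Type*} [NormedAddCommGroup E] [NormedSpace ℝ E]

/-- The homeomorphism of the unit sphere induced by a linear isometry. -/
def sphereHomeo (A : E ≃ₗᵢ[ℝ] E) : Metric.sphere (0 : E) 1 ≃ₜ Metric.sphere (0 : E) 1 :=
  A.toHomeomorph.subtype fun _ => by simp

lemma Ioo_smul_image_preimage_sphereHomeo (A : E ≃ₗᵢ[ℝ] E)
    (s : Set (Metric.sphere (0 : E) 1)) :
    Ioo (0 : ℝ) 1 • ((↑) '' (sphereHomeo A ⁻¹' s) : Set E) =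
      A ⁻¹' (Ioo (0 : ℝ) 1 • ((↑) '' s : Set E)) := by
  ext v
  simp only [mem_smul, mem_image, mem_preimage]
  constructor
  · rintro ⟨a, ha, _, ⟨x, hx, rfl⟩, rfl⟩
    exact ⟨a, ha, _, ⟨_, hx, rfl⟩, (map_smul A a x.1).symm⟩
  · rintro ⟨a, ha, _, ⟨x, hx, rfl⟩, h⟩
    obtain ⟨y, rfl⟩ := (sphereHomeo A).surjective x
    exact ⟨a, ha, _, ⟨y, hx, rfl⟩, A.injective ((map_smul A a y.1).trans h)⟩

variable [MeasurableSpace E] [BorelSpace E] (μ : Measure E)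

lemma measurePreserving_sphereHomeo {A : E ≃ₗᵢ[ℝ] E} (hA : MeasurePreserving A μ μ) :
    MeasurePreserving (sphereHomeo A) μ.toSphere μ.toSphere := by
  refine ⟨(sphereHomeo A).measurable, Measure.ext fun s hs => ?_⟩
  rw [Measure.map_apply (sphereHomeo A).measurable hs, Measure.toSphere_apply' _ hs,
    Measure.toSphere_apply' _ ((sphereHomeo A).measurable hs),
    Ioo_smul_image_preimage_sphereHomeo]
  congr 1
  exact hA.measure_preimage_equiv (f := A.toHomeomorph.toMeasurableEquiv) _

variable [FiniteDimensional ℝ E] [Nontrivial E] [μ.IsAddHaarMeasure]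

lemma integral_volumeIoiPow (n : ℕ) (g : ℝ → ℝ) :
    ∫ r : Ioi (0 : ℝ), g r ∂Measure.volumeIoiPow n = ∫ r in Ioi (0 : ℝ), r ^ n * g r := by
  simp only [Measure.volumeIoiPow, ENNReal.ofReal]
  rw [integral_withDensity_eq_integral_smul (measurable_subtype_coe.pow_const _).real_toNNReal,
    integral_subtype_comap measurableSet_Ioi fun r : ℝ => Real.toNNReal (r ^ n) • g r]
  refine setIntegral_congr_fun measurableSet_Ioi fun r hr => ?_
  simp only [NNReal.smul_def, Real.coe_toNNReal _ (pow_nonneg (mem_Ioi.1 hr).le _), smul_eq_mul]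

lemma integral_homogeneous_mul_radial {f : E → ℝ} {k : ℕ}
    (hf : ∀ r : ℝ, 0 < r → ∀ x, f (r • x) = r ^ k * f x) (g : ℝ → ℝ) :
    ∫ x, f x * g ‖x‖ ∂μ = (∫ x : Metric.sphere (0 : E) 1, f x ∂μ.toSphere) *
      ∫ r in Ioi (0 : ℝ), r ^ (Module.finrank ℝ E - 1 + k) * g r := by
  have polar := μ.measurePreserving_homeomorphUnitSphereProd.integral_comp
    (Homeomorph.measurableEmbedding _)
    (fun y : Metric.sphere (0 : E) 1 × Ioi (0 : ℝ) => f y.1 * (y.2.1 ^ k * g y.2))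
  calc ∫ x, f x * g ‖x‖ ∂μ
      = ∫ x : ({0}ᶜ : Set E), f x * g ‖x.1‖ ∂μ.comap (↑) := by
        rw [integral_subtype_comap (measurableSet_singleton _).compl fun x => f x * g ‖x‖,
          restrict_compl_singleton]
    _ = ∫ y : Metric.sphere (0 : E) 1 × Ioi (0 : ℝ), f y.1 * (y.2.1 ^ k * g y.2)
          ∂μ.toSphere.prod (.volumeIoiPow (Module.finrank ℝ E - 1)) := by
        rw [← polar]
        congr 1 with x
        have hx : 0 < ‖x.1‖ := norm_pos_iff.2 x.2
        rw [homeomorphUnitSphereProd_apply_fst_coe, homeomorphUnitSphereProd_apply_snd_coe,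
          hf _ (inv_pos.2 hx), inv_pow]
        field_simp
    _ = _ := by
        rw [integral_prod_mul (fun y : Metric.sphere (0 : E) 1 => f y)
          (fun r : Ioi (0 : ℝ) => r.1 ^ k * g r), integral_volumeIoiPow _ fun r => r ^ k * g r]
        simp only [pow_add, mul_assoc]

end SphereMeasure

section GaussMoment

open Set

/-- The half-line Gaussian moment, the radial factor of the Gaussian integral of a homogeneous
function. -/
def gaussMoment (k : ℕ) : ℝ := ∫ r in Ioi (0 : ℝ), r ^ k * Real.exp (-r ^ 2)

lemma gaussMoment_eq (k : ℕ) : gaussMoment k = 1 / 2 * Real.Gamma ((k + 1) / 2) := by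
  rw [← integral_rpow_mul_exp_neg_rpow two_pos
    (show (-1 : ℝ) < k by linarith [(Nat.cast_nonneg k : (0 : ℝ) ≤ k)]), gaussMoment]
  simp

lemma gaussMoment_pos (k : ℕ) : 0 < gaussMoment k := by
  rw [gaussMoment_eq]
  have := Real.Gamma_pos_of_pos (show (0 : ℝ) < (k + 1) / 2 by positivity)
  positivity

lemma gaussMoment_add_two (k : ℕ) : gaussMoment (k + 2) = (k + 1) / 2 * gaussMoment k := by
  rw [gaussMoment_eq, gaussMoment_eq,
    show (((k + 2 : ℕ) : ℝ) + 1) / 2 = (k + 1) / 2 + 1 by push_cast; ring,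
    Real.Gamma_add_one (by positivity)]
  ring

lemma integral_pow_mul_gauss_of_even {k : ℕ} (hk : Even k) :
    ∫ t : ℝ, t ^ k * Real.exp (-t ^ 2) = 2 * gaussMoment k := by
  rw [gaussMoment, ← integral_comp_abs (f := fun t : ℝ => t ^ k * Real.exp (-t ^ 2))]
  simp [hk.pow_abs]

lemma integral_pow_mul_gauss_of_odd {k : ℕ} (hk : Odd k) :
    ∫ t : ℝ, t ^ k * Real.exp (-t ^ 2) = 0 := by
  have h := integral_neg_eq_self (fun t : ℝ => t ^ k * Real.exp (-t ^ 2)) volume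
  simp only [hk.neg_pow, neg_sq, neg_mul, integral_neg] at h
  linarith

lemma integral_pow_mul_gauss {ι : Type*} [Fintype ι] (i : ι) (k : ℕ) :
    ∫ x : EuclideanSpace ℝ ι, x i ^ k * Real.exp (-‖x‖ ^ 2) =
      √Real.pi ^ (Fintype.card ι - 1) * ∫ t : ℝ, t ^ k * Real.exp (-t ^ 2) := by
  classical
  have gauss : ∫ t : ℝ, Real.exp (-t ^ 2) = √Real.pi := by simpa using integral_gaussian 1
  have separate (x : EuclideanSpace ℝ ι) : x i ^ k * Real.exp (-‖x‖ ^ 2) =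
      ∏ j, (x j ^ (if j = i then k else 0) * Real.exp (-(x j) ^ 2)) := by
    rw [Finset.prod_mul_distrib, ← Real.exp_sum, Finset.sum_neg_distrib,
      EuclideanSpace.real_norm_sq_eq, Finset.prod_eq_single i (by simp +contextual) (by simp),
      if_pos rfl]
  simp only [separate]
  rw [← (EuclideanSpace.volume_preserving_symm_measurableEquiv_toLp ι).symm.integral_comp']
  simp only [MeasurableEquiv.symm_symm, MeasurableEquiv.coe_toLp]
  rw [integral_fintype_prod_volume_eq_prod
    (fun (j : ι) (t : ℝ) => t ^ (if j = i then k else 0) * Real.exp (-t ^ 2)),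
    ← Finset.mul_prod_erase _ _ (Finset.mem_univ i), if_pos rfl, mul_comm]
  congr 1
  rw [Finset.prod_congr rfl fun j hj => ?_, Finset.prod_const,
    Finset.card_erase_of_mem (Finset.mem_univ i), Finset.card_univ]
  simp [Finset.ne_of_mem_erase hj, gauss]

end GaussMoment

section Area

instance : IsFiniteMeasure area := by unfold area; infer_instance

lemma integral_comp_sphereHomeo {F : Type*} [NormedAddCommGroup F] [NormedSpace ℝ F]
    (A : EuclideanSpace ℝ (Fin 3) ≃ₗᵢ[ℝ] EuclideanSpace ℝ (Fin 3)) (g : S2 → F) :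
    ∫ x, g (sphereHomeo A x) ∂area = ∫ x, g x ∂area :=
  (measurePreserving_sphereHomeo volume A.measurePreserving).integral_comp
    (sphereHomeo A).measurableEmbedding g

/-- Archimedes' hat-box theorem for powers of the height: the integral of the power against a
Gaussian over space is computed both in polar and in Cartesian coordinates. -/
lemma integral_coord_pow (k : ℕ) :
    ∫ x : S2, x.1 2 ^ k ∂area = 2 * Real.pi * ∫ t in (-1 : ℝ)..1, t ^ k := by
  have polar : (∫ x : S2, x.1 2 ^ k ∂area) * gaussMoment (k + 2) =
      Real.pi * ∫ t : ℝ, t ^ k * Real.exp (-t ^ 2) := by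
    have h := integral_homogeneous_mul_radial (volume : Measure (EuclideanSpace ℝ (Fin 3)))
      (f := fun x => x 2 ^ k) (k := k) (fun r _ x => by simp [mul_pow]) (fun r => Real.exp (-r ^ 2))
    rw [integral_pow_mul_gauss, finrank_euclideanSpace, Fintype.card_fin,
      Real.sq_sqrt Real.pi_pos.le, add_comm] at h
    exact h.symm
  rw [integral_pow]
  rcases Nat.even_or_odd k with hk | hk
  · rw [integral_pow_mul_gauss_of_even hk, gaussMoment_add_two] at polar
    have hpos := gaussMoment_pos k
    apply mul_right_cancel₀ (b := (k + 1) / 2 * gaussMoment k) (by positivity)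
    rw [polar, hk.add_one.neg_one_pow]
    field_simp
    norm_num
  · rw [integral_pow_mul_gauss_of_odd hk, mul_zero, mul_eq_zero] at polar
    rw [polar.resolve_right (gaussMoment_pos _).ne', hk.add_one.neg_one_pow]
    simp

lemma continuous_coord (i : Fin 3) : Continuous fun x : S2 => x.1 i := by
  fun_prop

lemma integrable_of_continuous {F : Type*} [NormedAddCommGroup F] {g : S2 → F}
    (hg : Continuous g) : Integrable g area :=
  hg.integrable_of_hasCompactSupport (HasCompactSupport.of_compactSpace _)

lemma integral_zonal (p : Polynomial ℝ) :
    ∫ x : S2, p.eval (x.1 2) ∂area = 2 * Real.pi * ∫ t in (-1 : ℝ)..1, p.eval t := by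
  induction p using Polynomial.induction_on' with
  | add p q hp hq =>
    have integrable (p : Polynomial ℝ) : Integrable (fun x : S2 => p.eval (x.1 2)) area :=
      integrable_of_continuous (p.continuous.comp (continuous_coord 2))
    simp only [Polynomial.eval_add]
    rw [intervalIntegral.integral_add (intervalIntegrable_eval _ _ _)
      (intervalIntegrable_eval _ _ _), integral_add (integrable p) (integrable q), hp, hq]
    ring
  | monomial k a =>
    simp only [Polynomial.eval_monomial]
    rw [intervalIntegral.integral_const_mul, integral_const_mul, integral_coord_pow]
    ring

end Area

/-! ### Rotations and the reflection as isometries -/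

section Isometries

/-- The linear isometry given by a norm-preserving linear endomorphism of a finite-dimensional
space. -/
def isometryOfNormSq {E : Type*} [NormedAddCommGroup E] [NormedSpace ℝ E] [FiniteDimensional ℝ E]
    (f : E →ₗ[ℝ] E) (hf : ∀ x, ‖f x‖ ^ 2 = ‖x‖ ^ 2) : E ≃ₗᵢ[ℝ] E :=
  LinearIsometry.toLinearIsometryEquiv
    ⟨f, fun x => (sq_eq_sq₀ (norm_nonneg _) (norm_nonneg _)).1 (hf x)⟩ rfl

/-- The rotation about the `z`-axis as a linear isometry, extending `rotZ`. -/
def rotZIsometry (a : ℝ) : EuclideanSpace ℝ (Fin 3) ≃ₗᵢ[ℝ] EuclideanSpace ℝ (Fin 3) :=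
  isometryOfNormSq
    { toFun := fun x => !₂[Real.cos a * x 0 - Real.sin a * x 1,
        Real.sin a * x 0 + Real.cos a * x 1, x 2]
      map_add' := fun x y => by ext i; fin_cases i <;> simp <;> ring
      map_smul' := fun c x => by ext i; fin_cases i <;> simp <;> ring }
    fun x => by
      simp only [LinearMap.coe_mk, AddHom.coe_mk, EuclideanSpace.real_norm_sq_eq,
        Fin.sum_univ_three, Matrix.cons_val_zero, Matrix.cons_val_one, Matrix.cons_val]
      linear_combination (x 0 ^ 2 + x 1 ^ 2) * Real.sin_sq_add_cos_sq a

/-- The rotation about the `y`-axis as a linear isometry, extending `rotY`. -/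
def rotYIsometry (a : ℝ) : EuclideanSpace ℝ (Fin 3) ≃ₗᵢ[ℝ] EuclideanSpace ℝ (Fin 3) :=
  isometryOfNormSq
    { toFun := fun x => !₂[Real.cos a * x 0 + Real.sin a * x 2, x 1,
        -Real.sin a * x 0 + Real.cos a * x 2]
      map_add' := fun x y => by ext i; fin_cases i <;> simp <;> ring
      map_smul' := fun c x => by ext i; fin_cases i <;> simp <;> ring }
    fun x => by
      simp only [neg_mul, LinearMap.coe_mk, AddHom.coe_mk, EuclideanSpace.real_norm_sq_eq,
        Fin.sum_univ_three, Matrix.cons_val_zero, Matrix.cons_val_one, Matrix.cons_val]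
      linear_combination (x 0 ^ 2 + x 2 ^ 2) * Real.sin_sq_add_cos_sq a

/-- The reflection in the `xz`-plane, which turns the longitude `φ` into `-φ`. -/
def reflection : EuclideanSpace ℝ (Fin 3) ≃ₗᵢ[ℝ] EuclideanSpace ℝ (Fin 3) :=
  isometryOfNormSq
    { toFun := fun x => !₂[x 0, -x 1, x 2]
      map_add' := fun x y => by ext i; fin_cases i <;> simp [add_comm]
      map_smul' := fun c x => by ext i; fin_cases i <;> simp }
    fun x => by simp [EuclideanSpace.real_norm_sq_eq, Fin.sum_univ_three]

lemma sphereHomeo_rotZIsometry (a : ℝ) : ⇑(sphereHomeo (rotZIsometry a)) = rotZ a := rfl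

lemma integral_eq_zero_of_rotZ {g : S2 → ℂ} {m : ℤ} (hm : m ≠ 0)
    (hg : ∀ (a : ℝ) (x : S2), g (rotZ a x) = Complex.exp (Complex.I * m * a) * g x) :
    ∫ x, g x ∂area = 0 := by
  have hexp : Complex.exp (Complex.I * m * (Real.pi / m : ℝ)) = -1 := by
    rw [← Complex.exp_pi_mul_I]
    congr 1
    have : (m : ℂ) ≠ 0 := Int.cast_ne_zero.2 hm
    push_cast
    field_simp
  have h := integral_comp_sphereHomeo (rotZIsometry (Real.pi / m)) g
  simp only [sphereHomeo_rotZIsometry, hg, hexp, neg_one_mul, integral_neg] at h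
  exact self_eq_neg.1 h.symm

end Isometries

/-! ### Spherical harmonics in Cartesian coordinates -/

section Cartesian

/-- The complex number `x + iy` attached to a point of the sphere. -/
def planar (x : S2) : ℂ := ⟨x.1 0, x.1 1⟩

lemma continuous_planar : Continuous planar := by
  have h : planar = fun x : S2 => (x.1 0 : ℂ) + (x.1 1 : ℂ) * Complex.I :=
    funext fun x => Complex.mk_eq_add_mul_I _ _
  rw [h]
  fun_prop

lemma normSq_planar (x : S2) : Complex.normSq (planar x) = 1 - x.1 2 ^ 2 := by
  rw [Complex.normSq_apply, planar]
  linear_combination norm_sq_coord x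

lemma norm_planar (x : S2) : ‖planar x‖ = √(1 - x.1 2 ^ 2) := by
  rw [← normSq_planar, Complex.normSq_eq_norm_sq, Real.sqrt_sq (norm_nonneg _)]

lemma planar_rotZ (a : ℝ) (x : S2) :
    planar (rotZ a x) = Complex.exp (Complex.I * a) * planar x := by
  rw [mul_comm Complex.I, Complex.exp_mul_I, ← Complex.ofReal_cos, ← Complex.ofReal_sin]
  apply Complex.ext
  · simp [planar, rotZ, -Complex.ofReal_cos, -Complex.ofReal_sin]
  · simp [planar, rotZ, -Complex.ofReal_cos, -Complex.ofReal_sin, add_comm]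

/-- The Cartesian form of `sin^|m| θ · e^{imφ}`: the power `(x + iy)^m` for `m ≥ 0` and
`(x - iy)^|m|` for `m ≤ 0`. -/
def planarPow (m : ℤ) (x : S2) : ℂ := planar x ^ m.toNat * conj (planar x) ^ (-m).toNat

lemma planarPow_natCast (k : ℕ) (x : S2) : planarPow k x = planar x ^ k := by
  simp [planarPow]

lemma planarPow_neg (m : ℤ) (x : S2) : planarPow (-m) x = conj (planarPow m x) := by
  simp [planarPow, mul_comm]

lemma continuous_planarPow (m : ℤ) : Continuous (planarPow m) := by
  have := continuous_planar
  unfold planarPow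
  fun_prop

lemma planarPow_mul_conj (m : ℤ) (x : S2) :
    planarPow m x * conj (planarPow m x) = ((1 - x.1 2 ^ 2 : ℝ) : ℂ) ^ m.natAbs := by
  rw [← normSq_planar, Complex.mul_conj, planarPow, map_mul, map_pow, map_pow, Complex.normSq_conj,
    ← pow_add, Int.toNat_add_toNat_neg_eq_natAbs, Complex.ofReal_pow]

lemma planarPow_rotZ (m : ℤ) (a : ℝ) (x : S2) :
    planarPow m (rotZ a x) = Complex.exp (Complex.I * m * a) * planarPow m x := by
  have natCast (k : ℕ) : planarPow k (rotZ a x) =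
      Complex.exp (Complex.I * k * a) * planarPow k x := by
    rw [planarPow_natCast, planarPow_natCast, planar_rotZ, mul_pow, ← Complex.exp_nat_mul]
    ring_nf
  obtain ⟨k, rfl | rfl⟩ := m.eq_nat_or_neg
  · exact natCast k
  · rw [planarPow_neg, planarPow_neg, natCast, map_mul, ← Complex.exp_conj]
    simp

lemma sqrt_pow_mul_exp_longitude (m : ℤ) (x : S2) :
    ((√(1 - x.1 2 ^ 2) ^ m.natAbs : ℝ) : ℂ) * Complex.exp (Complex.I * m * longitude x) =
      planarPow m x := by
  have natCast (k : ℕ) : ((√(1 - x.1 2 ^ 2) ^ k : ℝ) : ℂ) *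
      Complex.exp (Complex.I * k * longitude x) = planarPow k x := by
    rw [planarPow_natCast, ← Complex.norm_mul_exp_arg_mul_I (planar x), mul_pow,
      ← Complex.exp_nat_mul, norm_planar, Complex.ofReal_pow, longitude, planar]
    ring_nf
  obtain ⟨k, rfl | rfl⟩ := m.eq_nat_or_neg
  · exact natCast k
  · rw [planarPow_neg, ← natCast, map_mul, Complex.conj_ofReal, ← Complex.exp_conj]
    simp

lemma cos_colatitude (x : S2) : Real.cos (colatitude x) = x.1 2 := by
  have h := norm_sq_coord x
  exact Real.cos_arccos (by nlinarith [sq_nonneg (x.1 0), sq_nonneg (x.1 1)])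
    (by nlinarith [sq_nonneg (x.1 0), sq_nonneg (x.1 1)])

lemma legendre_natCast (l k : ℕ) (t : ℝ) : legendre l k t = legendreNonneg l k t := by
  simp [legendre]

lemma legendre_neg_natCast (l k : ℕ) (t : ℝ) :
    legendre l (-k) t =
      (-1) ^ k * ((l - k).factorial / (l + k).factorial) * legendreNonneg l k t := by
  rcases k.eq_zero_or_pos with rfl | hk
  · simp [legendre, Nat.factorial_ne_zero]
  · have hneg : ¬ (0 : ℤ) ≤ -(k : ℤ) := by omega
    rw [legendre, if_neg hneg, Int.natAbs_neg, Int.natAbs_natCast]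

lemma normFactor_natCast {l k : ℕ} (h : k ≤ l) :
    normFactor l k =
      √((2 * l + 1) / (4 * Real.pi) * ((l - k).factorial / (l + k).factorial)) := by
  rw [normFactor, show ((l : ℤ) - k).toNat = l - k by omega,
    show ((l : ℤ) + k).toNat = l + k by omega]

lemma normFactor_neg_natCast {l k : ℕ} (h : k ≤ l) :
    normFactor l (-k) * ((l - k).factorial / (l + k).factorial) = normFactor l k := by
  rw [normFactor_natCast h, normFactor, show ((l : ℤ) - -(k : ℤ)).toNat = l + k by omega,
    show ((l : ℤ) + -(k : ℤ)).toNat = l - k by omega]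
  refine ((Real.sqrt_eq_iff_mul_self_eq (by positivity) (by positivity)).2 ?_).symm
  rw [mul_mul_mul_comm, Real.mul_self_sqrt (by positivity)]
  field_simp

/-- The constant in the Cartesian form of the spherical harmonics. Its sign is the
Condon-Shortley phase `(-1)^m` for `m ≥ 0`, and `1` for `m ≤ 0`. -/
def harmConst (l : ℕ) (m : ℤ) : ℝ :=
  (-1) ^ m.toNat * (normFactor l m.natAbs / (2 ^ l * l.factorial))

lemma sphHarm_eq {l : ℕ} {m : ℤ} (h : m.natAbs ≤ l) (x : S2) :
    sphHarm l m x =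
      harmConst l m * ((rodrigues l m.natAbs).eval (x.1 2) : ℝ) * planarPow m x := by
  rw [← sqrt_pow_mul_exp_longitude]
  obtain ⟨k, rfl | rfl⟩ := m.eq_nat_or_neg
  · rw [sphHarm, legendre_natCast, legendreNonneg, cos_colatitude, harmConst, rodrigues]
    simp only [Int.toNat_natCast, Int.natAbs_natCast]
    push_cast
    ring
  · rw [Int.natAbs_neg, Int.natAbs_natCast] at h
    have hsign : (-1 : ℂ) ^ k * (-1) ^ k = 1 := pow_mul_pow_eq_one _ (by norm_num)
    rw [sphHarm, legendre_neg_natCast, legendreNonneg, cos_colatitude, harmConst, rodrigues,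
      Int.natAbs_neg, Int.natAbs_natCast, ← normFactor_neg_natCast h]
    simp only [Int.toNat_neg_natCast]
    push_cast
    linear_combination (normFactor l (-k) * ((l - k).factorial / (l + k).factorial) /
      (2 ^ l * l.factorial) * √(1 - x.1 2 ^ 2) ^ k *
      ((Polynomial.derivative^[l + k] ((Polynomial.X ^ 2 - 1) ^ l)).eval (x.1 2) : ℝ) *
      Complex.exp (Complex.I * -k * longitude x) : ℂ) * hsign

lemma continuous_sphHarm {l : ℕ} {m : ℤ} (h : m.natAbs ≤ l) : Continuous (sphHarm l m) := by
  have := continuous_planarPow m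
  rw [show sphHarm l m = _ from funext (sphHarm_eq h)]
  fun_prop

lemma sphHarm_neg {l : ℕ} {m : ℤ} (h : m.natAbs ≤ l) (x : S2) :
    sphHarm l (-m) x = (-1) ^ m.natAbs * conj (sphHarm l m x) := by
  have hsign : (-1 : ℂ) ^ m.toNat * (-1) ^ m.toNat = 1 := pow_mul_pow_eq_one _ (by norm_num)
  rw [sphHarm_eq h, sphHarm_eq (m.natAbs_neg.trans_le h), planarPow_neg, harmConst, harmConst,
    Int.natAbs_neg, ← Int.toNat_add_toNat_neg_eq_natAbs, pow_add]
  simp only [map_mul, Complex.conj_ofReal]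
  push_cast
  linear_combination -((-1) ^ (-m).toNat * (normFactor l (m.toNat + (-m).toNat)) /
      (2 ^ l * l.factorial) * ((rodrigues l (m.toNat + (-m).toNat)).eval (x.1 2) : ℝ) *
      conj (planarPow m x)) * hsign

lemma sphHarm_rotZ {l : ℕ} {m : ℤ} (h : m.natAbs ≤ l) (a : ℝ) (x : S2) :
    sphHarm l m (rotZ a x) = Complex.exp (Complex.I * m * a) * sphHarm l m x := by
  rw [sphHarm_eq h, sphHarm_eq h, planarPow_rotZ, show (rotZ a x).1 2 = x.1 2 from rfl]
  ring

lemma harmConst_sq {l : ℕ} {m : ℤ} (h : m.natAbs ≤ l) :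
    harmConst l m ^ 2 * (2 * Real.pi * (2 * (2 ^ l * l.factorial) ^ 2 / (2 * l + 1) *
      ((l + m.natAbs).factorial / (l - m.natAbs).factorial))) = 1 := by
  have := Real.pi_ne_zero
  rw [harmConst, mul_pow, pow_right_comm, neg_one_sq, one_pow, one_mul, div_pow,
    normFactor_natCast h, Real.sq_sqrt (by positivity)]
  field_simp
  ring

lemma harmConst_ne_zero {l : ℕ} {m : ℤ} (h : m.natAbs ≤ l) : harmConst l m ≠ 0 := by
  intro h0
  simpa [h0] using harmConst_sq h

lemma integral_sphHarm_mul_conj_of_ord_ne {l l' : ℕ} {m m' : ℤ} (h : m.natAbs ≤ l)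
    (h' : m'.natAbs ≤ l') (hm : m ≠ m') :
    ∫ x, sphHarm l m x * conj (sphHarm l' m' x) ∂area = 0 := by
  refine integral_eq_zero_of_rotZ (sub_ne_zero.2 hm) fun a x => ?_
  rw [sphHarm_rotZ h, sphHarm_rotZ h', map_mul, ← Complex.exp_conj, mul_mul_mul_comm,
    ← Complex.exp_add]
  congr 2
  simp
  ring

lemma integral_sphHarm_mul_conj_eq_rodrigues {l l' : ℕ} {m : ℤ} (h : m.natAbs ≤ l)
    (h' : m.natAbs ≤ l') :
    ∫ x, sphHarm l m x * conj (sphHarm l' m x) ∂area =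
      (harmConst l m * harmConst l' m * (-1) ^ m.natAbs * (2 * Real.pi *
        ∫ t in (-1 : ℝ)..1, (rodrigues l m.natAbs * ((Polynomial.X ^ 2 - 1) ^ m.natAbs *
          rodrigues l' m.natAbs)).eval t) : ℝ) := by
  have hpt (x : S2) : sphHarm l m x * conj (sphHarm l' m x) =
      ((harmConst l m * harmConst l' m * (-1) ^ m.natAbs * (rodrigues l m.natAbs *
        ((Polynomial.X ^ 2 - 1) ^ m.natAbs * rodrigues l' m.natAbs)).eval (x.1 2) : ℝ) : ℂ) := by
    have hplanar := planarPow_mul_conj m x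
    rw [← neg_sub, Complex.ofReal_neg, neg_pow] at hplanar
    rw [sphHarm_eq h, sphHarm_eq h']
    simp only [map_mul, Complex.conj_ofReal, Polynomial.eval_mul, Polynomial.eval_pow,
      Polynomial.eval_sub, Polynomial.eval_X, Polynomial.eval_one]
    push_cast at hplanar ⊢
    linear_combination (harmConst l m : ℂ) * harmConst l' m *
      ((rodrigues l m.natAbs).eval (x.1 2) : ℝ) *
      ((rodrigues l' m.natAbs).eval (x.1 2) : ℝ) * hplanar
  simp only [hpt]
  rw [integral_complex_ofReal, integral_const_mul, integral_zonal]

lemma integral_sphHarm_mul_conj_of_deg_lt {l l' : ℕ} {m : ℤ} (h' : m.natAbs ≤ l')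
    (hl : l' < l) : ∫ x, sphHarm l m x * conj (sphHarm l' m x) ∂area = 0 := by
  rw [integral_sphHarm_mul_conj_eq_rodrigues (h'.trans hl.le) h',
    integral_rodrigues_mul_of_lt hl h', mul_zero, mul_zero, Complex.ofReal_zero]

lemma integral_sphHarm_mul_conj_self {l : ℕ} {m : ℤ} (h : m.natAbs ≤ l) :
    ∫ x, sphHarm l m x * conj (sphHarm l m x) ∂area = 1 := by
  have hsign : (-1 : ℝ) ^ m.natAbs * (-1) ^ m.natAbs = 1 := pow_mul_pow_eq_one _ (by norm_num)
  rw [integral_sphHarm_mul_conj_eq_rodrigues h h, integral_rodrigues_mul_self h]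
  refine (congrArg Complex.ofReal (Eq.trans ?_ (harmConst_sq h))).trans Complex.ofReal_one
  linear_combination harmConst l m ^ 2 * (2 * Real.pi * (2 * (2 ^ l * l.factorial) ^ 2 /
    (2 * l + 1) * ((l + m.natAbs).factorial / (l - m.natAbs).factorial))) * hsign

lemma integral_mul_conj_swap (f g : S2 → ℂ) :
    ∫ x, f x * conj (g x) ∂area = conj (∫ x, g x * conj (f x) ∂area) := by
  rw [← integral_conj]
  simp only [map_mul, Complex.conj_conj, mul_comm]

lemma integral_sphHarm_mul_conj {l l' : ℕ} {m m' : ℤ} (h : m.natAbs ≤ l) (h' : m'.natAbs ≤ l') :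
    ∫ x, sphHarm l m x * conj (sphHarm l' m' x) ∂area = if l = l' ∧ m = m' then 1 else 0 := by
  rcases eq_or_ne m m' with rfl | hm
  · rcases lt_trichotomy l l' with hl | rfl | hl
    · rw [integral_mul_conj_swap, integral_sphHarm_mul_conj_of_deg_lt h hl, map_zero,
        if_neg fun hll => hl.ne hll.1]
    · rw [integral_sphHarm_mul_conj_self h, if_pos ⟨rfl, rfl⟩]
    · rw [integral_sphHarm_mul_conj_of_deg_lt h' hl, if_neg fun hll => hl.ne' hll.1]
  · rw [integral_sphHarm_mul_conj_of_ord_ne h h' hm, if_neg fun hmm => hm hmm.2]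

end Cartesian

/-! ### The single index -/

section Index

lemma natAbs_ord_le (n : ℕ) : (ord n).natAbs ≤ deg n := by
  have lower : deg n * deg n ≤ n := Nat.sqrt_le n
  have upper : n ≤ deg n * deg n + deg n + deg n := Nat.sqrt_le_add n
  rw [ord, mul_add_one]
  zify at lower upper
  omega

lemma idx_cast {l : ℕ} {m : ℤ} (h : m.natAbs ≤ l) : (idx l m : ℤ) = (l : ℤ) * l + l + m := by
  rw [idx, Int.toNat_of_nonneg (by nlinarith [show -(l : ℤ) ≤ m by omega, sq_nonneg (l : ℤ)]), sq]

lemma deg_idx {l : ℕ} {m : ℤ} (h : m.natAbs ≤ l) : deg (idx l m) = l := by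
  have hcast := idx_cast h
  rw [deg, eq_comm, Nat.eq_sqrt]
  zify
  constructor <;> linarith [show -(l : ℤ) ≤ m by omega, show m ≤ (l : ℤ) by omega]

lemma ord_idx {l : ℕ} {m : ℤ} (h : m.natAbs ≤ l) : ord (idx l m) = m := by
  rw [ord, deg_idx h, idx_cast h]
  ring

lemma idx_deg_ord (n : ℕ) : idx (deg n) (ord n) = n := by
  zify
  rw [idx_cast (natAbs_ord_le n), ord]
  ring

lemma deg_le_iff (n L : ℕ) : deg n ≤ L ↔ n < (L + 1) ^ 2 := by
  rw [deg, ← Nat.lt_succ_iff, Nat.sqrt_lt', Nat.succ_eq_add_one]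

lemma Y_idx {l : ℕ} {m : ℤ} (h : m.natAbs ≤ l) : Y (idx l m) = sphHarm l m := by
  ext x
  rw [Y, deg_idx h, ord_idx h]

lemma continuous_Y (n : ℕ) : Continuous (Y n) := continuous_sphHarm (natAbs_ord_le n)

lemma integral_Y_mul_conj (n k : ℕ) :
    ∫ x, Y n x * conj (Y k x) ∂area = if n = k then 1 else 0 := by
  have hiff : (deg n = deg k ∧ ord n = ord k) ↔ n = k :=
    ⟨fun ⟨hdeg, hord⟩ => by rw [← idx_deg_ord n, ← idx_deg_ord k, hdeg, hord], by rintro rfl; simp⟩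
  simp only [Y, integral_sphHarm_mul_conj (natAbs_ord_le n) (natAbs_ord_le k), hiff]

/-- The single index of the pair `(l, -m)`, where `(l, m) ↔ r`. -/
def negIdx (r : ℕ) : ℕ := idx (deg r) (-ord r)

lemma conj_Y (r : ℕ) (x : S2) : conj (Y r x) = (-1) ^ (ord r).natAbs * Y (negIdx r) x := by
  have hsign : (-1 : ℂ) ^ (ord r).natAbs * (-1) ^ (ord r).natAbs = 1 :=
    pow_mul_pow_eq_one _ (by norm_num)
  have h := natAbs_ord_le r
  rw [negIdx, Y_idx ((Int.natAbs_neg _).trans_le h), sphHarm_neg h, ← mul_assoc, hsign, one_mul, Y]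

end Index

/-! ### Polynomial functions on the sphere are spanned by spherical harmonics -/

section Polynomials

open Submodule

/-- The coordinates as complex functions on the sphere. -/
def coordFun (i : Fin 3) (x : S2) : ℂ := (x.1 i : ℂ)

/-- The affine functions on the sphere; their `l`-th power is the space of polynomial functions of
degree at most `l`. -/
def affineSpan : Submodule ℂ (S2 → ℂ) := span ℂ (insert 1 (Set.range coordFun))

/-- The span of the spherical harmonics of degree at most `l`. -/
def harmSpan (l : ℕ) : Submodule ℂ (S2 → ℂ) := span ℂ (Y '' {n | deg n ≤ l})

/-- The span of the functions `(x ± iy)^|m| z^k` with `|m| + k ≤ l`. -/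
def cylSpan (l : ℕ) : Submodule ℂ (S2 → ℂ) :=
  span ℂ {g | ∃ (m : ℤ) (k : ℕ), m.natAbs + k ≤ l ∧ g = planarPow m * coordFun 2 ^ k}

lemma one_mem_affineSpan : (1 : S2 → ℂ) ∈ affineSpan := subset_span (by simp)

lemma coordFun_mem_affineSpan (i : Fin 3) : coordFun i ∈ affineSpan := subset_span (by simp)

lemma affineSpan_pow_mono {l l' : ℕ} (h : l ≤ l') : affineSpan ^ l ≤ affineSpan ^ l' :=
  pow_le_pow_right₀ (one_le.2 one_mem_affineSpan) h

lemma planar_eq : planar = coordFun 0 + Complex.I • coordFun 1 := by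
  ext x
  exact (Complex.mk_eq_add_mul_I _ _).trans (congrArg _ (mul_comm _ _))

lemma conj_coordFun (i : Fin 3) : conj (coordFun i) = coordFun i := by
  ext x
  exact Complex.conj_ofReal _

lemma conj_planar_eq : conj planar = coordFun 0 - Complex.I • coordFun 1 := by
  ext x
  simp [planar_eq, coordFun, sub_eq_add_neg]

lemma coordFun_zero_eq : coordFun 0 = (1 / 2 : ℂ) • (planar + conj planar) := by
  rw [conj_planar_eq, planar_eq]
  module

lemma coordFun_one_eq : coordFun 1 = (-Complex.I / 2) • (planar - conj planar) := by
  rw [conj_planar_eq, planar_eq, add_sub_sub_cancel, ← two_smul ℂ, smul_smul, smul_smul,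
    show -Complex.I / 2 * 2 * Complex.I = 1 by linear_combination -Complex.I_mul_I, one_smul]

lemma planarPow_eq (m : ℤ) : planarPow m = planar ^ m.toNat * conj planar ^ (-m).toNat := rfl

lemma aeval_coordFun_apply (i : Fin 3) (p : Polynomial ℝ) (x : S2) :
    Polynomial.aeval (coordFun i) p x = (p.eval (x.1 i) : ℝ) := by
  rw [Polynomial.aeval_pi_apply]
  exact Polynomial.aeval_algebraMap_apply_eq_algebraMap_eval (x.1 i) p

lemma sphHarm_eq_smul {l : ℕ} {m : ℤ} (h : m.natAbs ≤ l) :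
    sphHarm l m = (harmConst l m : ℂ) •
      (planarPow m * Polynomial.aeval (coordFun 2) (rodrigues l m.natAbs)) := by
  ext x
  rw [sphHarm_eq h, Pi.smul_apply, Pi.mul_apply, aeval_coordFun_apply, smul_eq_mul]
  ring

lemma planarPow_mem_affineSpan_pow (m : ℤ) : planarPow m ∈ affineSpan ^ m.natAbs := by
  have hplanar : planar ∈ affineSpan := planar_eq ▸
    add_mem (coordFun_mem_affineSpan 0) (smul_mem _ _ (coordFun_mem_affineSpan 1))
  have hconj : conj planar ∈ affineSpan := conj_planar_eq ▸
    sub_mem (coordFun_mem_affineSpan 0) (smul_mem _ _ (coordFun_mem_affineSpan 1))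
  rw [planarPow_eq, ← Int.toNat_add_toNat_neg_eq_natAbs, pow_add]
  exact mul_mem_mul (pow_mem_pow _ hplanar _) (pow_mem_pow _ hconj _)

lemma aeval_coordFun_mem_affineSpan_pow (i : Fin 3) (p : Polynomial ℝ) :
    Polynomial.aeval (coordFun i) p ∈ affineSpan ^ p.natDegree := by
  rw [Polynomial.aeval_eq_sum_range]
  exact sum_mem fun j hj => smul_of_tower_mem _ _ (affineSpan_pow_mono
    (Nat.lt_succ_iff.1 (Finset.mem_range.1 hj)) (pow_mem_pow _ (coordFun_mem_affineSpan i) _))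

lemma Y_mem_affineSpan_pow (n : ℕ) : Y n ∈ affineSpan ^ deg n := by
  have h := natAbs_ord_le n
  rw [← idx_deg_ord n, Y_idx h, sphHarm_eq_smul h, deg_idx h]
  have hmul := mul_mem_mul (planarPow_mem_affineSpan_pow (ord n))
    (affineSpan_pow_mono (natDegree_rodrigues_le (deg n) (ord n).natAbs)
      (aeval_coordFun_mem_affineSpan_pow 2 _))
  rw [← pow_add, Nat.add_sub_cancel' h] at hmul
  exact smul_mem _ _ hmul

lemma harmSpan_le_affineSpan_pow (l : ℕ) : harmSpan l ≤ affineSpan ^ l := by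
  rw [harmSpan, span_le]
  rintro _ ⟨n, hn, rfl⟩
  exact affineSpan_pow_mono hn (Y_mem_affineSpan_pow n)

lemma planar_mul_conj_planar : planar * conj planar = 1 - coordFun 2 ^ 2 := by
  ext x
  refine (Complex.mul_conj _).trans ?_
  rw [normSq_planar]
  simp [coordFun]

lemma planar_mul_planarPow {m : ℤ} (h : 0 ≤ m) : planar * planarPow m = planarPow (m + 1) := by
  rw [planarPow_eq, planarPow_eq, show (m + 1).toNat = m.toNat + 1 by omega,
    show (-(m + 1)).toNat = (-m).toNat by omega]
  ring

lemma planar_mul_planarPow_of_neg {m : ℤ} (h : m < 0) :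
    planar * planarPow m = (1 - coordFun 2 ^ 2) * planarPow (m + 1) := by
  rw [planarPow_eq, planarPow_eq, show (m + 1).toNat = m.toNat by omega,
    show (-m).toNat = (-(m + 1)).toNat + 1 by omega, ← planar_mul_conj_planar]
  ring

lemma planarPow_mul_pow_mem_cylSpan {m : ℤ} {k l : ℕ} (h : m.natAbs + k ≤ l) :
    planarPow m * coordFun 2 ^ k ∈ cylSpan l :=
  subset_span ⟨m, k, h, rfl⟩

lemma planar_mul_mem_cylSpan {m : ℤ} {k l : ℕ} (h : m.natAbs + k ≤ l) :
    planar * (planarPow m * coordFun 2 ^ k) ∈ cylSpan (l + 1) := by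
  rw [← mul_assoc]
  rcases le_or_gt 0 m with hm | hm
  · rw [planar_mul_planarPow hm]
    exact planarPow_mul_pow_mem_cylSpan (by omega)
  · rw [planar_mul_planarPow_of_neg hm, show (1 - coordFun 2 ^ 2) * planarPow (m + 1) *
      coordFun 2 ^ k = planarPow (m + 1) * coordFun 2 ^ k -
        planarPow (m + 1) * coordFun 2 ^ (k + 2) by ring]
    exact sub_mem (planarPow_mul_pow_mem_cylSpan (by omega))
      (planarPow_mul_pow_mem_cylSpan (by omega))

lemma conj_planarPow_mul_pow (m : ℤ) (k : ℕ) :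
    conj (planarPow m * coordFun 2 ^ k) = planarPow (-m) * coordFun 2 ^ k := by
  rw [map_mul, map_pow, conj_coordFun, funext (planarPow_neg m)]
  rfl

lemma conj_mem_cylSpan {l : ℕ} {g : S2 → ℂ} (hg : g ∈ cylSpan l) : conj g ∈ cylSpan l := by
  induction hg using span_induction with
  | mem g hg =>
    obtain ⟨m, k, h, rfl⟩ := hg
    rw [conj_planarPow_mul_pow]
    exact planarPow_mul_pow_mem_cylSpan (by omega)
  | zero => simp
  | add f g _ _ hf hg =>
    rw [map_add]
    exact add_mem hf hg
  | smul a f _ hf =>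
    rw [starRingEnd_apply, star_smul]
    exact smul_mem _ _ hf

lemma conj_planar_mul_mem_cylSpan {m : ℤ} {k l : ℕ} (h : m.natAbs + k ≤ l) :
    conj planar * (planarPow m * coordFun 2 ^ k) ∈ cylSpan (l + 1) := by
  have hneg := conj_mem_cylSpan (planar_mul_mem_cylSpan (m := -m) (k := k) (l := l) (by omega))
  rwa [map_mul, conj_planarPow_mul_pow, neg_neg] at hneg

lemma coordFun_mul_mem_cylSpan (i : Fin 3) {m : ℤ} {k l : ℕ} (h : m.natAbs + k ≤ l) :
    coordFun i * (planarPow m * coordFun 2 ^ k) ∈ cylSpan (l + 1) := by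
  have hplanar := planar_mul_mem_cylSpan h
  have hconj := conj_planar_mul_mem_cylSpan h
  fin_cases i
  · rw [Fin.zero_eta, coordFun_zero_eq, smul_mul_assoc, add_mul]
    exact smul_mem _ _ (add_mem hplanar hconj)
  · rw [Fin.mk_one, coordFun_one_eq, smul_mul_assoc, sub_mul]
    exact smul_mem _ _ (sub_mem hplanar hconj)
  · rw [show (⟨2, by omega⟩ : Fin 3) = 2 from rfl, mul_left_comm, ← pow_succ']
    exact planarPow_mul_pow_mem_cylSpan (by omega)

lemma affineSpan_mul_cylSpan_le (l : ℕ) : affineSpan * cylSpan l ≤ cylSpan (l + 1) := by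
  rw [affineSpan, cylSpan, span_mul_span, span_le]
  rintro _ ⟨f, rfl | ⟨i, rfl⟩, _, ⟨m, k, h, rfl⟩, rfl⟩
  · simpa using planarPow_mul_pow_mem_cylSpan (Nat.le_succ_of_le h)
  · exact coordFun_mul_mem_cylSpan i h

lemma affineSpan_pow_le_cylSpan (l : ℕ) : affineSpan ^ l ≤ cylSpan l := by
  induction l with
  | zero =>
    rw [pow_zero, Submodule.one_le]
    simpa [planarPow_eq] using planarPow_mul_pow_mem_cylSpan (m := 0) (k := 0) (l := 0) le_rfl
  | succ l ih =>
    rw [pow_succ']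
    exact (mul_le_mul_right ih _).trans (affineSpan_mul_cylSpan_le l)

lemma planarPow_mul_rodrigues_mem_harmSpan {m : ℤ} {d l : ℕ} (hm : m.natAbs ≤ d) (hd : d ≤ l) :
    planarPow m * Polynomial.aeval (coordFun 2) (rodrigues d m.natAbs) ∈ harmSpan l := by
  have hne : (harmConst d m : ℂ) ≠ 0 := Complex.ofReal_ne_zero.2 (harmConst_ne_zero hm)
  rw [← smul_mem_iff _ hne, ← sphHarm_eq_smul hm, ← Y_idx hm]
  exact subset_span ⟨_, (deg_idx hm).trans_le hd, rfl⟩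

/-- The top coefficient of `p` is removed by a multiple of the Rodrigues polynomial of the same
degree. -/
lemma planarPow_mul_aeval_mem_harmSpan {m : ℤ} {k l : ℕ} (h : m.natAbs + k ≤ l + 1)
    (p : Polynomial ℝ) (hp : p.degree < k) :
    planarPow m * Polynomial.aeval (coordFun 2) p ∈ harmSpan l := by
  induction k generalizing p with
  | zero => simp [Polynomial.degree_eq_bot.1 (Nat.WithBot.lt_zero_iff.1 hp)]
  | succ k ih =>
    have hm : m.natAbs ≤ m.natAbs + k := Nat.le_add_right _ _
    set R := rodrigues (m.natAbs + k) m.natAbs with hR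
    have hcoeff : R.coeff k ≠ 0 := by
      have h := coeff_rodrigues hm
      rw [Nat.add_sub_cancel_left] at h
      rw [hR, h]
      positivity
    have hlower : (p - (p.coeff k / R.coeff k) • R).degree < k := by
      rw [Polynomial.degree_lt_iff_coeff_zero] at hp ⊢
      intro j hj
      rw [Polynomial.coeff_sub, Polynomial.coeff_smul, smul_eq_mul]
      rcases hj.eq_or_lt with rfl | hj
      · rw [div_mul_cancel₀ _ hcoeff, sub_self]
      · have hRj : R.coeff j = 0 := Polynomial.coeff_eq_zero_of_natDegree_lt
          ((natDegree_rodrigues_le _ _).trans_lt (by omega))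
        rw [hp j hj, hRj, mul_zero, sub_zero]
    have hsum := add_mem (ih (by omega) _ hlower) (smul_of_tower_mem _ (p.coeff k / R.coeff k)
      (planarPow_mul_rodrigues_mem_harmSpan hm (Nat.lt_succ_iff.1 (by omega))))
    rwa [map_sub, map_smul, mul_sub, mul_smul_comm, sub_add_cancel] at hsum

lemma cylSpan_le_harmSpan (l : ℕ) : cylSpan l ≤ harmSpan l := by
  rw [cylSpan, span_le]
  rintro _ ⟨m, k, h, rfl⟩
  have hmem := planarPow_mul_aeval_mem_harmSpan (m := m) (k := k + 1) (l := l) (by omega)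
    (Polynomial.X ^ k) (by rw [Polynomial.degree_X_pow]; exact_mod_cast k.lt_succ_self)
  rwa [map_pow, Polynomial.aeval_X] at hmem

theorem affineSpan_pow_eq_harmSpan (l : ℕ) : affineSpan ^ l = harmSpan l :=
  le_antisymm ((affineSpan_pow_le_cylSpan l).trans (cylSpan_le_harmSpan l))
    (harmSpan_le_affineSpan_pow l)

lemma mul_mem_harmSpan {l l' : ℕ} {f g : S2 → ℂ} (hf : f ∈ harmSpan l) (hg : g ∈ harmSpan l') :
    f * g ∈ harmSpan (l + l') := by
  rw [← affineSpan_pow_eq_harmSpan] at *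
  rw [pow_add]
  exact mul_mem_mul hf hg

lemma harmSpan_mono {l l' : ℕ} (h : l ≤ l') : harmSpan l ≤ harmSpan l' :=
  span_mono (Set.image_mono fun _ hn => le_trans hn h)

lemma Y_mem_harmSpan (n : ℕ) : Y n ∈ harmSpan (deg n) := subset_span ⟨n, le_refl (deg n), rfl⟩

lemma conj_mem_harmSpan {l : ℕ} {g : S2 → ℂ} (hg : g ∈ harmSpan l) : conj g ∈ harmSpan l :=
  cylSpan_le_harmSpan l (conj_mem_cylSpan
    (affineSpan_pow_le_cylSpan l ((affineSpan_pow_eq_harmSpan l).ge hg)))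

/-- Composition with the map of the sphere induced by a linear isometry. -/
def compAlgHom (A : EuclideanSpace ℝ (Fin 3) ≃ₗᵢ[ℝ] EuclideanSpace ℝ (Fin 3)) :
    (S2 → ℂ) →ₐ[ℂ] (S2 → ℂ) where
  toFun g := g ∘ sphereHomeo A
  map_one' := rfl
  map_mul' _ _ := rfl
  map_zero' := rfl
  map_add' _ _ := rfl
  commutes' _ := rfl

lemma compAlgHom_coordFun (A : EuclideanSpace ℝ (Fin 3) ≃ₗᵢ[ℝ] EuclideanSpace ℝ (Fin 3))
    (i : Fin 3) : compAlgHom A (coordFun i) =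
      ∑ j, ((A (EuclideanSpace.single j 1) i : ℝ) : ℂ) • coordFun j := by
  ext x
  have hx : x.1 = ∑ j, x.1 j • EuclideanSpace.single j (1 : ℝ) := by
    ext k
    fin_cases k <;> simp [Fin.sum_univ_three]
  change ((A x.1 i : ℝ) : ℂ) = _
  nth_rw 1 [hx]
  simp [coordFun, mul_comm]

lemma map_affineSpan_le (A : EuclideanSpace ℝ (Fin 3) ≃ₗᵢ[ℝ] EuclideanSpace ℝ (Fin 3)) :
    affineSpan.map (compAlgHom A).toLinearMap ≤ affineSpan := by
  rw [map_le_iff_le_comap]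
  nth_rw 1 [affineSpan]
  rw [span_le]
  rintro f (rfl | ⟨i, rfl⟩)
  · exact one_mem_affineSpan
  · change compAlgHom A (coordFun i) ∈ affineSpan
    rw [compAlgHom_coordFun]
    exact sum_mem fun j _ => smul_mem _ _ (coordFun_mem_affineSpan j)

lemma comp_mem_harmSpan (A : EuclideanSpace ℝ (Fin 3) ≃ₗᵢ[ℝ] EuclideanSpace ℝ (Fin 3)) {l : ℕ}
    {g : S2 → ℂ} (hg : g ∈ harmSpan l) : g ∘ sphereHomeo A ∈ harmSpan l := by
  rw [← affineSpan_pow_eq_harmSpan] at *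
  have hmap : (affineSpan ^ l).map (compAlgHom A).toLinearMap ≤ affineSpan ^ l := by
    rw [Submodule.map_pow]
    exact pow_le_pow_left' (map_affineSpan_le A) l
  exact hmap (mem_map_of_mem hg)

end Polynomials

/-! ### Harmonic coefficients -/

section Coefficients

lemma memLp_of_continuous {g : S2 → ℂ} (hg : Continuous g) (p : ℝ≥0∞) : MemLp g p area := by
  obtain ⟨C, hC⟩ := isCompact_univ.exists_bound_of_continuousOn hg.continuousOn
  exact MemLp.of_bound hg.aestronglyMeasurable C (.of_forall fun x => hC x trivial)

lemma continuous_conj_Y (n : ℕ) : Continuous fun x => conj (Y n x) :=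
  Complex.continuous_conj.comp (continuous_Y n)

lemma integrable_mul_conj_Y {f : S2 → ℂ} (hf : MemLp f 2 area) (n : ℕ) :
    Integrable (fun x => f x * conj (Y n x)) area :=
  hf.integrable_mul (memLp_of_continuous (continuous_conj_Y n) 2)

lemma coeff_add {f g : S2 → ℂ} (hf : MemLp f 2 area) (hg : MemLp g 2 area) (n : ℕ) :
    coeff (f + g) n = coeff f n + coeff g n := by
  simp only [coeff, Pi.add_apply, add_mul]
  exact integral_add (integrable_mul_conj_Y hf n) (integrable_mul_conj_Y hg n)

lemma coeff_sub {f g : S2 → ℂ} (hf : MemLp f 2 area) (hg : MemLp g 2 area) (n : ℕ) :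
    coeff (f - g) n = coeff f n - coeff g n := by
  simp only [coeff, Pi.sub_apply, sub_mul]
  exact integral_sub (integrable_mul_conj_Y hf n) (integrable_mul_conj_Y hg n)

lemma memLp_sum_Y (s : Finset ℕ) (c : ℕ → ℂ) : MemLp (fun x => ∑ n ∈ s, c n * Y n x) 2 area :=
  memLp_of_continuous
    (continuous_finsetSum _ fun n _ => continuous_const.mul (continuous_Y n)) 2

lemma coeff_sum_Y (s : Finset ℕ) (c : ℕ → ℂ) (k : ℕ) :
    coeff (fun x => ∑ n ∈ s, c n * Y n x) k = if k ∈ s then c k else 0 := by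
  have integrable (n : ℕ) : Integrable (fun x => c n * (Y n x * conj (Y k x))) area :=
    (integrable_of_continuous ((continuous_Y n).mul (continuous_conj_Y k))).const_mul _
  simp only [coeff, Finset.sum_mul, mul_assoc]
  rw [integral_finsetSum _ fun n _ => integrable n]
  simp [integral_const_mul, integral_Y_mul_conj]

lemma eq_sum_coeff_of_mem_harmSpan {l : ℕ} {g : S2 → ℂ} (hg : g ∈ harmSpan l) :
    g = fun x => ∑ n ∈ Finset.range ((l + 1) ^ 2), coeff g n * Y n x := by
  have hindex : {n | deg n ≤ l} = (Finset.range ((l + 1) ^ 2) : Set ℕ) := by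
    ext n
    simp [deg_le_iff]
  rw [harmSpan, hindex, Submodule.mem_span_image_finset_iff_exists_fun'] at hg
  obtain ⟨c, rfl⟩ := hg
  ext x
  have hsum : ∑ n ∈ Finset.range ((l + 1) ^ 2), c n • Y n =
      fun x => ∑ n ∈ Finset.range ((l + 1) ^ 2), c n * Y n x := by
    ext x
    simp
  rw [hsum]
  exact Finset.sum_congr rfl fun n hn => by rw [coeff_sum_Y, if_pos hn]

lemma coeff_eq_zero_of_mem_harmSpan {l n : ℕ} {g : S2 → ℂ} (hg : g ∈ harmSpan l)
    (hn : (l + 1) ^ 2 ≤ n) : coeff g n = 0 := by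
  rw [eq_sum_coeff_of_mem_harmSpan hg, coeff_sum_Y, if_neg (by simpa using hn)]

end Coefficients

/-! ### Completeness of the spherical harmonics -/

section Completeness

open Submodule

/-- The spherical harmonics as continuous maps. -/
def continuousY (n : ℕ) : C(S2, ℂ) := ⟨Y n, continuous_Y n⟩

/-- The spherical harmonics as elements of `L²`. -/
def lpY (n : ℕ) : Lp ℂ 2 area := ContinuousMap.toLp 2 area ℂ (continuousY n)

/-- The star subalgebra of polynomial functions on the sphere. -/
def polyAlgebra : StarSubalgebra ℂ C(S2, ℂ) where
  carrier := {g | ∃ l, (g : S2 → ℂ) ∈ harmSpan l}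
  mul_mem' := fun ⟨l, hl⟩ ⟨l', hl'⟩ => ⟨l + l', mul_mem_harmSpan hl hl'⟩
  add_mem' := fun ⟨l, hl⟩ ⟨l', hl'⟩ =>
    ⟨max l l', add_mem (harmSpan_mono (le_max_left _ _) hl) (harmSpan_mono (le_max_right _ _) hl')⟩
  algebraMap_mem' := fun a => ⟨0, by
    rw [← affineSpan_pow_eq_harmSpan, pow_zero, one_eq_span]
    exact mem_span_singleton.2 ⟨a, by ext x; simp⟩⟩
  star_mem' := fun ⟨l, hl⟩ => ⟨l, conj_mem_harmSpan hl⟩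

lemma polyAlgebra_separatesPoints : polyAlgebra.SeparatesPoints := by
  intro x y hxy
  obtain ⟨i, hi⟩ : ∃ i, x.1 i ≠ y.1 i := by
    by_contra! h
    exact hxy (Subtype.ext (PiLp.ext h))
  refine ⟨coordFun i, ⟨⟨coordFun i, Complex.continuous_ofReal.comp (continuous_coord i)⟩,
    ⟨1, ?_⟩, rfl⟩, by simpa [coordFun] using hi⟩
  rw [← affineSpan_pow_eq_harmSpan, pow_one]
  exact coordFun_mem_affineSpan i

lemma polyAlgebra_le_span :
    Subalgebra.toSubmodule polyAlgebra.toSubalgebra ≤ span ℂ (Set.range continuousY) := by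
  rintro g ⟨l, hl⟩
  have hsum : g = ∑ n ∈ Finset.range ((l + 1) ^ 2), coeff g n • continuousY n := by
    ext x
    simpa [continuousY] using congrFun (eq_sum_coeff_of_mem_harmSpan hl) x
  rw [hsum]
  exact sum_mem fun n _ => smul_mem _ _ (subset_span ⟨n, rfl⟩)

lemma span_continuousY_topologicalClosure :
    (span ℂ (Set.range continuousY)).topologicalClosure = ⊤ := by
  rw [eq_top_iff]
  intro g _
  have hg : g ∈ polyAlgebra.topologicalClosure := by
    rw [ContinuousMap.starSubalgebra_topologicalClosure_eq_top_of_separatesPoints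
      polyAlgebra polyAlgebra_separatesPoints]
    trivial
  exact closure_mono (s := (polyAlgebra : Set C(S2, ℂ))) polyAlgebra_le_span hg

lemma span_lpY_topologicalClosure : (span ℂ (Set.range lpY)).topologicalClosure = ⊤ := by
  have h := (ContinuousMap.toLp_denseRange ℂ area ℂ (p := 2)
    ENNReal.ofNat_ne_top).topologicalClosure_map_submodule span_continuousY_topologicalClosure
  rwa [map_span, ← Set.range_comp] at h

lemma coeFn_lpY (n : ℕ) : lpY n =ᵐ[area] Y n :=
  ContinuousMap.coeFn_toLp (p := 2) area (𝕜 := ℂ) (continuousY n)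

lemma inner_lpY {f : S2 → ℂ} (hf : MemLp f 2 area) (n : ℕ) :
    inner ℂ (lpY n) (hf.toLp f) = coeff f n := by
  rw [L2.inner_def, coeff]
  refine integral_congr_ae ?_
  filter_upwards [hf.coeFn_toLp, coeFn_lpY n] with x hfx hYx
  rw [hfx, hYx, RCLike.inner_apply]

lemma orthonormal_lpY : Orthonormal ℂ lpY := by
  rw [orthonormal_iff_ite]
  intro i j
  have hY := memLp_of_continuous (continuous_Y j) 2
  have hj : lpY j = hY.toLp (Y j) := Lp.ext ((coeFn_lpY j).trans hY.coeFn_toLp.symm)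
  rw [hj, inner_lpY, coeff, integral_Y_mul_conj]
  simp only [eq_comm]

/-- The spherical harmonics as a Hilbert basis of `L²`. -/
def harmonicBasis : HilbertBasis ℕ ℂ (Lp ℂ 2 area) :=
  HilbertBasis.mk orthonormal_lpY span_lpY_topologicalClosure.ge

lemma enorm_sq_eq_ofReal {E : Type*} [SeminormedAddGroup E] (v : E) :
    ‖v‖ₑ ^ 2 = ENNReal.ofReal (‖v‖ ^ 2) := by
  rw [ENNReal.ofReal_pow (norm_nonneg v), ofReal_norm]

lemma tsum_enorm_inner_sq {ι 𝕜 E : Type*} [RCLike 𝕜] [NormedAddCommGroup E]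
    [InnerProductSpace 𝕜 E] (b : HilbertBasis ι 𝕜 E) (v : E) :
    ∑' i, ‖inner 𝕜 (b i) v‖ₑ ^ 2 = ‖v‖ₑ ^ 2 := by
  have h := lp.hasSum_norm (p := 2) (by norm_num) (b.repr v)
  simp only [ENNReal.toReal_ofNat, Real.rpow_ofNat, b.repr_apply_apply,
    LinearIsometryEquiv.norm_map] at h
  simp only [enorm_sq_eq_ofReal]
  rw [← ENNReal.ofReal_tsum_of_nonneg (fun _ => by positivity) h.summable, h.tsum_eq]

lemma tsum_enorm_coeff_sq {f : S2 → ℂ} (hf : MemLp f 2 area) :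
    ∑' n, ‖coeff f n‖ₑ ^ 2 = ∫⁻ x, ‖f x‖ₑ ^ 2 ∂area := by
  have h := tsum_enorm_inner_sq harmonicBasis (hf.toLp f)
  simp only [harmonicBasis, HilbertBasis.coe_mk, inner_lpY] at h
  rw [h, Lp.enorm_toLp]
  simpa using eLpNorm_nnreal_pow_eq_lintegral (f := f) (μ := area) (p := 2) two_ne_zero

lemma ae_eq_of_coeff_eq {f g : S2 → ℂ} (hf : MemLp f 2 area) (hg : MemLp g 2 area)
    (h : ∀ n, coeff f n = coeff g n) : f =ᵐ[area] g := by
  have hfg := hf.sub hg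
  have hzero := tsum_enorm_coeff_sq hfg
  simp only [coeff_sub hf hg, h, sub_self, enorm_zero, ne_eq, OfNat.ofNat_ne_zero,
    not_false_eq_true, zero_pow, tsum_zero] at hzero
  rw [eq_comm, lintegral_eq_zero_iff' (hfg.aestronglyMeasurable.enorm.pow_const 2)] at hzero
  filter_upwards [hzero] with x hx
  simpa [sub_eq_zero] using hx

lemma lintegral_enorm_sum_Y_sq (s : Finset ℕ) (c : ℕ → ℂ) :
    ∫⁻ x, ‖∑ n ∈ s, c n * Y n x‖ₑ ^ 2 ∂area = ∑ n ∈ s, ‖c n‖ₑ ^ 2 := by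
  rw [← tsum_enorm_coeff_sq (memLp_sum_Y s c),
    tsum_eq_sum (s := s) fun n hn => by simp [coeff_sum_Y, hn]]
  exact Finset.sum_congr rfl fun n hn => by rw [coeff_sum_Y, if_pos hn]

end Completeness

/-! ### The addition theorem -/

section Addition

open Matrix

lemma sum_mulVec_mul_conj {ι : Type*} [Fintype ι] [DecidableEq ι] {U : Matrix ι ι ℂ}
    (hU : U ∈ unitaryGroup ι ℂ) (a b : ι → ℂ) :
    ∑ i, (U *ᵥ a) i * conj ((U *ᵥ b) i) = ∑ i, a i * conj (b i) := by
  have h : U *ᵥ a ⬝ᵥ star (U *ᵥ b) = a ⬝ᵥ star b := by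
    rw [dotProduct_comm, star_mulVec, ← dotProduct_mulVec, mulVec_mulVec, ← star_eq_conjTranspose,
      mem_unitaryGroup_iff'.1 hU, one_mulVec, dotProduct_comm]
  exact h

/-- The matrix by which the isometry `A` acts, through composition, on the spherical harmonics of
degree at most `l`. -/
def wignerMatrix (A : EuclideanSpace ℝ (Fin 3) ≃ₗᵢ[ℝ] EuclideanSpace ℝ (Fin 3)) (l : ℕ) :
    Matrix (Fin ((l + 1) ^ 2)) (Fin ((l + 1) ^ 2)) ℂ :=
  of fun n k => coeff (Y n ∘ sphereHomeo A) k

variable (A : EuclideanSpace ℝ (Fin 3) ≃ₗᵢ[ℝ] EuclideanSpace ℝ (Fin 3))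

lemma Y_sphereHomeo (l : ℕ) (n : Fin ((l + 1) ^ 2)) (x : S2) :
    Y n (sphereHomeo A x) = (wignerMatrix A l *ᵥ fun k => Y k x) n := by
  have hn : Y n ∈ harmSpan l := harmSpan_mono ((deg_le_iff n l).2 n.2) (Y_mem_harmSpan n)
  rw [← Function.comp_apply (f := Y n), eq_sum_coeff_of_mem_harmSpan (comp_mem_harmSpan A hn)]
  exact (Fin.sum_univ_eq_sum_range (fun k => coeff (Y n ∘ sphereHomeo A) k * Y k x) _).symm

lemma wignerMatrix_mem_unitaryGroup (l : ℕ) : wignerMatrix A l ∈ unitaryGroup _ ℂ := by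
  rw [mem_unitaryGroup_iff]
  ext n n'
  have integrable (k : Fin ((l + 1) ^ 2)) : Integrable
      (fun x => conj (wignerMatrix A l n' k) * (Y n (sphereHomeo A x) * conj (Y k x))) area :=
    integrable_of_continuous (continuous_const.mul
      (((continuous_Y n).comp (sphereHomeo A).continuous).mul (continuous_conj_Y k)))
  calc ∑ k, wignerMatrix A l n k * conj (wignerMatrix A l n' k)
      = ∑ k, ∫ x, conj (wignerMatrix A l n' k) * (Y n (sphereHomeo A x) * conj (Y k x)) ∂area :=
        Finset.sum_congr rfl fun k _ => by rw [integral_const_mul, mul_comm]; rfl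
    _ = ∫ x, Y n (sphereHomeo A x) * conj (Y n' (sphereHomeo A x)) ∂area := by
        rw [← integral_finsetSum _ fun k _ => integrable k]
        simp only [Y_sphereHomeo A l n', mulVec, dotProduct, map_sum, map_mul, Finset.mul_sum,
          mul_left_comm]
    _ = (1 : Matrix _ _ ℂ) n n' := by
        rw [integral_comp_sphereHomeo A fun x => Y n x * conj (Y n' x), integral_Y_mul_conj,
          one_apply]
        simp only [Fin.ext_iff]

/-- The reproducing kernel of the spherical harmonics of degree less than `l`. -/
def kernelBelow (l : ℕ) (x y : S2) : ℂ := ∑ n ∈ Finset.range (l ^ 2), Y n x * conj (Y n y)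

lemma kernelBelow_sphereHomeo (l : ℕ) (x y : S2) :
    kernelBelow l (sphereHomeo A x) (sphereHomeo A y) = kernelBelow l x y := by
  cases l with
  | zero => simp [kernelBelow]
  | succ l =>
    have h (x y : S2) : kernelBelow (l + 1) x y = ∑ n : Fin ((l + 1) ^ 2), Y n x * conj (Y n y) :=
      (Fin.sum_univ_eq_sum_range (fun n => Y n x * conj (Y n y)) _).symm
    simp only [h, Y_sphereHomeo]
    exact sum_mulVec_mul_conj (wignerMatrix_mem_unitaryGroup A l) _ _

/-- The reproducing kernel of the spherical harmonics of degree `l`. -/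
def kernelDeg (l : ℕ) (x y : S2) : ℂ :=
  ∑ n ∈ Finset.Ico (l ^ 2) ((l + 1) ^ 2), Y n x * conj (Y n y)

lemma kernelDeg_sphereHomeo (l : ℕ) (x y : S2) :
    kernelDeg l (sphereHomeo A x) (sphereHomeo A y) = kernelDeg l x y := by
  have h (x y : S2) : kernelDeg l x y = kernelBelow (l + 1) x y - kernelBelow l x y :=
    Finset.sum_Ico_eq_sub _ (Nat.pow_le_pow_left l.le_succ 2)
  rw [h, h, kernelBelow_sphereHomeo, kernelBelow_sphereHomeo]

/-- The north pole. -/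
def northPole : S2 := ⟨!₂[0, 0, 1], mem_sphere_of_sq (by norm_num)⟩

open Polynomial in
lemma eval_one_rodrigues_zero (l : ℕ) : (rodrigues l 0).eval 1 = 2 ^ l * l.factorial := by
  have factorization : (X ^ 2 - 1 : ℝ[X]) ^ l = (X - C 1) ^ l * (X + 1) ^ l := by
    rw [← mul_pow, map_one]
    ring
  have vanishing {k : ℕ} (hkl : k ≤ l) (hk : k ≠ 0) :
      (derivative^[l - k] ((X - C 1 : ℝ[X]) ^ l)).eval 1 = 0 := by
    rw [iterate_derivative_X_sub_pow, Nat.sub_sub_self hkl, eval_smul, eval_pow, eval_sub, eval_X,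
      eval_C, sub_self, zero_pow hk, smul_zero]
  rw [rodrigues, add_zero, factorization, iterate_derivative_mul, eval_finsetSum,
    Finset.sum_eq_single_of_mem 0 (Finset.mem_range.2 l.succ_pos)]
  · simp only [Nat.choose_zero_right, one_smul, Nat.sub_zero, iterate_derivative_X_sub_pow_self,
      Function.iterate_zero, id, eval_mul, eval_natCast, eval_pow, eval_add, eval_X, eval_one]
    rw [one_add_one_eq_two, mul_comm]
  · intro k hk hk0
    rw [eval_smul, eval_mul, vanishing (Finset.mem_range_succ_iff.1 hk) hk0, zero_mul, smul_zero]

lemma Y_northPole_of_ord_ne_zero {n : ℕ} (h : ord n ≠ 0) : Y n northPole = 0 := by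
  have hp : planar northPole = 0 := by apply Complex.ext <;> simp [planar, northPole]
  have hm : (ord n).toNat ≠ 0 ∨ (-ord n).toNat ≠ 0 := by omega
  rw [Y, sphHarm_eq (natAbs_ord_le n), planarPow, hp, map_zero]
  rcases hm with hm | hm <;> simp [zero_pow hm]

lemma Y_northPole (l : ℕ) : Y (idx l 0) northPole = (√((2 * l + 1) / (4 * Real.pi)) : ℝ) := by
  have hl : (0 : ℤ).natAbs ≤ l := l.zero_le
  have height : northPole.1 2 = 1 := by simp [northPole]
  have hfact : (l.factorial : ℝ) ≠ 0 := by positivity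
  rw [Y_idx hl, sphHarm_eq hl, height, Int.natAbs_zero, eval_one_rodrigues_zero, harmConst,
    Int.natAbs_zero, normFactor_natCast l.zero_le, ← Complex.ofReal_mul]
  simp [planarPow, hfact]

/-- The rotation taking the point `y` of the sphere to the north pole. -/
def poleIsometry (y : S2) : EuclideanSpace ℝ (Fin 3) ≃ₗᵢ[ℝ] EuclideanSpace ℝ (Fin 3) :=
  (rotZIsometry (-longitude y)).trans (rotYIsometry (-colatitude y))

lemma sphereHomeo_poleIsometry (y x : S2) :
    sphereHomeo (poleIsometry y) x = rotY (-colatitude y) (rotZ (-longitude y) x) := rfl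

lemma sin_colatitude (x : S2) : Real.sin (colatitude x) = √(1 - x.1 2 ^ 2) := Real.sin_arccos _

lemma sin_colatitude_mul_cos_longitude (x : S2) :
    Real.sin (colatitude x) * Real.cos (longitude x) = x.1 0 := by
  rw [sin_colatitude, ← norm_planar]
  exact Complex.norm_mul_cos_arg _

lemma sin_colatitude_mul_sin_longitude (x : S2) :
    Real.sin (colatitude x) * Real.sin (longitude x) = x.1 1 := by
  rw [sin_colatitude, ← norm_planar]
  exact Complex.norm_mul_sin_arg _

lemma sphereHomeo_poleIsometry_self (y : S2) : sphereHomeo (poleIsometry y) y = northPole := by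
  have hlong := Real.sin_sq_add_cos_sq (longitude y)
  have hcolat := Real.sin_sq_add_cos_sq (colatitude y)
  rw [sphereHomeo_poleIsometry]
  ext i
  fin_cases i <;>
    simp [rotY, rotZ, northPole, ← sin_colatitude_mul_cos_longitude y,
      ← sin_colatitude_mul_sin_longitude y, ← cos_colatitude y]
  · linear_combination Real.cos (colatitude y) * Real.sin (colatitude y) * hlong
  · ring
  · linear_combination Real.sin (colatitude y) ^ 2 * hlong + hcolat

lemma mem_Ico_sq_iff {n l : ℕ} : n ∈ Finset.Ico (l ^ 2) ((l + 1) ^ 2) ↔ deg n = l := by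
  rw [Finset.mem_Ico, ← deg_le_iff, ← Nat.le_sqrt', deg]
  omega

lemma kernelDeg_northPole (l : ℕ) (x : S2) :
    kernelDeg l x northPole = Y (idx l 0) x * (√((2 * l + 1) / (4 * Real.pi)) : ℝ) := by
  have hl : (0 : ℤ).natAbs ≤ l := l.zero_le
  rw [kernelDeg, Finset.sum_eq_single_of_mem (idx l 0) (mem_Ico_sq_iff.2 (deg_idx hl)),
    Y_northPole, Complex.conj_ofReal]
  intro n hn hne
  have hord : ord n ≠ 0 := fun h => hne (by rw [← idx_deg_ord n, mem_Ico_sq_iff.1 hn, h])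
  rw [Y_northPole_of_ord_ne_zero hord, map_zero, mul_zero]

/-- Rotation invariance of the kernel moves `y` to the north pole, where only the zonal harmonic
survives. -/
theorem Y_zonal_poleIsometry (l : ℕ) (x y : S2) :
    Y (idx l 0) (sphereHomeo (poleIsometry y) x) =
      (√(4 * Real.pi / (2 * l + 1)) : ℝ) * kernelDeg l x y := by
  have hsqrt : √(4 * Real.pi / (2 * l + 1)) * √((2 * l + 1) / (4 * Real.pi)) = 1 := by
    rw [← Real.sqrt_mul (by positivity), Real.sqrt_eq_one, div_mul_div_cancel₀ (by positivity),
      div_self (by positivity)]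
  rw [← kernelDeg_sphereHomeo (poleIsometry y), sphereHomeo_poleIsometry_self,
    kernelDeg_northPole, mul_left_comm, ← Complex.ofReal_mul, hsqrt, Complex.ofReal_one, mul_one]

end Addition

/-! ### The harmonic expansion of the SLSHT distribution -/

section Window

/-- Azimuthal symmetry: the function depends on the co-latitude only. -/
def IsZonal (h : S2 → ℂ) : Prop := ∀ x x' : S2, colatitude x = colatitude x' → h x = h x'

variable {L : ℕ} {h : S2 → ℂ}

lemma IsZonal.coeff_eq_zero (hs : IsZonal h) {n : ℕ} (hn : ord n ≠ 0) : coeff h n = 0 := by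
  refine integral_eq_zero_of_rotZ (neg_ne_zero.2 hn) fun a x => ?_
  rw [hs (rotZ a x) x rfl, Y, sphHarm_rotZ (natAbs_ord_le n), map_mul, ← Complex.exp_conj]
  simp [Y, mul_left_comm]

lemma IsBandLimited.ae_eq_sum (hb : IsBandLimited L h) :
    h =ᵐ[area] fun x => ∑ n ∈ Finset.range ((L + 1) ^ 2), coeff h n * Y n x := by
  refine ae_eq_of_coeff_eq hb.1 (memLp_sum_Y _ _) fun n => ?_
  rw [coeff_sum_Y]
  split_ifs with hn
  · rfl
  · exact hb.2 n (not_le.1 fun hL => hn (Finset.mem_range.2 ((deg_le_iff n L).1 hL)))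

lemma sum_range_sq {M : Type*} [AddCommMonoid M] (F : ℕ → M) (L : ℕ) :
    ∑ n ∈ Finset.range (L ^ 2), F n =
      ∑ p ∈ Finset.range L, ∑ n ∈ Finset.Ico (p ^ 2) ((p + 1) ^ 2), F n := by
  induction L with
  | zero => simp
  | succ L ih =>
    rw [Finset.sum_range_succ, ← ih,
      Finset.sum_range_add_sum_Ico _ (Nat.pow_le_pow_left L.le_succ 2)]

lemma IsZonal.ae_eq_sum (hs : IsZonal h) (hb : IsBandLimited L h) :
    h =ᵐ[area] fun x => ∑ p ∈ Finset.range (L + 1), coeff h (idx p 0) * Y (idx p 0) x := by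
  filter_upwards [hb.ae_eq_sum] with x hx
  rw [hx, sum_range_sq]
  refine Finset.sum_congr rfl fun p _ => Finset.sum_eq_single_of_mem _
    (mem_Ico_sq_iff.2 (deg_idx p.zero_le)) fun n hn hne => ?_
  rw [hs.coeff_eq_zero, zero_mul]
  exact fun hord => hne (by rw [← idx_deg_ord n, mem_Ico_sq_iff.1 hn, hord])

lemma rotate_ae_eq (hs : IsZonal h) (hb : IsBandLimited L h) (y : S2) :
    rotate y h =ᵐ[area] fun x => ∑ r ∈ Finset.range ((L + 1) ^ 2),
      (√(4 * Real.pi / (2 * deg r + 1)) : ℝ) * coeff h (idx (deg r) 0) * conj (Y r y) * Y r x := by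
  have hpole := (measurePreserving_sphereHomeo volume
    (poleIsometry y).measurePreserving).quasiMeasurePreserving.ae_eq_comp (hs.ae_eq_sum hb)
  filter_upwards [hpole] with x hx
  rw [rotate, ← sphereHomeo_poleIsometry, ← Function.comp_apply (f := h), hx,
    Function.comp_apply, sum_range_sq]
  refine Finset.sum_congr rfl fun p _ => ?_
  rw [Y_zonal_poleIsometry, kernelDeg, Finset.mul_sum, Finset.mul_sum]
  refine Finset.sum_congr rfl fun r hr => ?_
  rw [mem_Ico_sq_iff.1 hr]
  ring

/-- The factor of `H(c; r; n)` that depends on the window. -/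
def windowFactor (h : S2 → ℂ) (r : ℕ) : ℂ :=
  (-1) ^ (ord r).natAbs * (√(4 * Real.pi / (2 * deg r + 1)) : ℂ) * coeff h (idx (deg r) 0)

lemma H_eq (h : S2 → ℂ) (c r n : ℕ) : H h c r n = windowFactor h r * T c (negIdx r) n := rfl

lemma natAbs_neg_ord_le (r : ℕ) : (-ord r).natAbs ≤ deg r := by
  rw [Int.natAbs_neg]
  exact natAbs_ord_le r

lemma deg_negIdx (r : ℕ) : deg (negIdx r) = deg r := deg_idx (natAbs_neg_ord_le r)

lemma ord_negIdx (r : ℕ) : ord (negIdx r) = -ord r := ord_idx (natAbs_neg_ord_le r)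

lemma negIdx_negIdx (r : ℕ) : negIdx (negIdx r) = r := by
  rw [negIdx, deg_negIdx, ord_negIdx, neg_neg, idx_deg_ord]

lemma negIdx_mem_range_sq {r : ℕ} (hr : r ∈ Finset.range ((L + 1) ^ 2)) :
    negIdx r ∈ Finset.range ((L + 1) ^ 2) := by
  rw [Finset.mem_range, ← deg_le_iff] at hr ⊢
  rwa [deg_negIdx]

lemma memLp_Y_mul {f : S2 → ℂ} (hf : MemLp f 2 area) (k : ℕ) : MemLp (Y k * f) 2 area :=
  hf.mul (memLp_of_continuous (continuous_Y k) ∞)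

/-- The sum over `r` is reindexed by `r ↦ negIdx r`, because the rotated window has the
coefficients `conj (Y r y)`, which are the values at `y` of the harmonics of the opposite order. -/
theorem slsht_eq_sum {f : S2 → ℂ} (hs : IsZonal h) (hb : IsBandLimited L h)
    (hf : MemLp f 2 area) (n : ℕ) (y : S2) :
    slsht h f n y = ∑ r ∈ Finset.range ((L + 1) ^ 2),
      windowFactor h r * coeff (Y (negIdx r) * f) n * Y r y := by
  calc slsht h f n y
      = ∫ x, ∑ r ∈ Finset.range ((L + 1) ^ 2),
          ((√(4 * Real.pi / (2 * deg r + 1)) : ℝ) * coeff h (idx (deg r) 0) * conj (Y r y)) *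
            ((Y r * f) x * conj (Y n x)) ∂area := by
        refine integral_congr_ae ?_
        filter_upwards [rotate_ae_eq hs hb y] with x hx
        rw [hx, Finset.sum_mul, Finset.sum_mul]
        exact Finset.sum_congr rfl fun r _ => by rw [Pi.mul_apply]; ring
    _ = ∑ r ∈ Finset.range ((L + 1) ^ 2),
          ((√(4 * Real.pi / (2 * deg r + 1)) : ℝ) * coeff h (idx (deg r) 0) * conj (Y r y)) *
            coeff (Y r * f) n := by
        rw [integral_finsetSum _ fun r _ =>
          (integrable_mul_conj_Y (memLp_Y_mul hf r) n).const_mul _]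
        simp only [integral_const_mul, coeff]
    _ = ∑ r ∈ Finset.range ((L + 1) ^ 2),
          windowFactor h r * coeff (Y (negIdx r) * f) n * Y r y := by
        refine Finset.sum_nbij' negIdx negIdx (fun _ => negIdx_mem_range_sq)
          (fun _ => negIdx_mem_range_sq) (fun r _ => negIdx_negIdx r)
          (fun r _ => negIdx_negIdx r) fun r _ => ?_
        rw [conj_Y, windowFactor, deg_negIdx, ord_negIdx, negIdx_negIdx, Int.natAbs_neg]
        ring

end Window

/-! ### Triple products -/

section TripleProduct

lemma planarPow_reflection (m : ℤ) (x : S2) :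
    planarPow m (sphereHomeo reflection x) = conj (planarPow m x) := by
  have hplanar : planar (sphereHomeo reflection x) = conj (planar x) := by
    apply Complex.ext <;> rfl
  rw [planarPow, planarPow, hplanar, map_mul, map_pow, map_pow]

lemma Y_reflection (n : ℕ) (x : S2) : Y n (sphereHomeo reflection x) = conj (Y n x) := by
  have height : (sphereHomeo reflection x).1 2 = x.1 2 := rfl
  rw [Y, Y, sphHarm_eq (natAbs_ord_le n), sphHarm_eq (natAbs_ord_le n), planarPow_reflection,
    height, map_mul, map_mul, Complex.conj_ofReal, Complex.conj_ofReal]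

lemma conj_T (c k n : ℕ) : conj (T c k n) = T c k n := by
  rw [T, ← integral_conj, ← integral_comp_sphereHomeo reflection]
  simp only [Y_reflection, map_mul, Complex.conj_conj]

lemma coeff_conj_Y_mul (k n c : ℕ) : coeff (conj (Y k) * Y n) c = T c k n := by
  rw [← conj_T, T, ← integral_conj, coeff]
  refine integral_congr_ae (.of_forall fun x => ?_)
  simp only [Pi.mul_apply, Pi.conj_apply, map_mul, Complex.conj_conj]
  ring

lemma conj_Y_mul_mem_harmSpan (k n : ℕ) : conj (Y k) * Y n ∈ harmSpan (deg k + deg n) :=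
  mul_mem_harmSpan (conj_mem_harmSpan (Y_mem_harmSpan k)) (Y_mem_harmSpan n)

/-- The bound on the indices `c` of the non-zero triple products `T(c; k; n)`. -/
def tripleBound (k n : ℕ) : ℕ := (deg k + deg n + 1) ^ 2

lemma T_eq_zero {c k n : ℕ} (h : tripleBound k n ≤ c) : T c k n = 0 := by
  rw [← coeff_conj_Y_mul]
  exact coeff_eq_zero_of_mem_harmSpan (conj_Y_mul_mem_harmSpan k n) h

/-- The `n`-th coefficient of `Y k * f` as a function of the sequence of coefficients of `f`. -/
def mulYCoeff (k n : ℕ) (a : ℕ → ℂ) : ℂ := ∑ c ∈ Finset.range (tripleBound k n), T c k n * a c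

lemma Y_mul_conj_Y (k n : ℕ) (x : S2) :
    Y k x * conj (Y n x) = mulYCoeff k n fun c => conj (Y c x) := by
  have h := congrArg conj
    (congrFun (eq_sum_coeff_of_mem_harmSpan (conj_Y_mul_mem_harmSpan k n)) x)
  simpa only [mulYCoeff, tripleBound, Pi.mul_apply, Pi.conj_apply, coeff_conj_Y_mul, map_sum,
    map_mul, conj_T, Complex.conj_conj] using h

lemma coeff_Y_mul {f : S2 → ℂ} (hf : MemLp f 2 area) (k n : ℕ) :
    coeff (Y k * f) n = mulYCoeff k n (coeff f) := by
  have integrand (x : S2) : (Y k * f) x * conj (Y n x) =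
      ∑ c ∈ Finset.range (tripleBound k n), T c k n * (f x * conj (Y c x)) := by
    rw [Pi.mul_apply, mul_right_comm, Y_mul_conj_Y, mulYCoeff, Finset.sum_mul]
    exact Finset.sum_congr rfl fun c _ => by ring
  simp only [coeff, integrand, mulYCoeff]
  rw [integral_finsetSum _ fun c _ => (integrable_mul_conj_Y hf c).const_mul _]
  simp only [integral_const_mul]

end TripleProduct

/-! ### Scalar Wiener filtering -/

section Wiener

/-- The mean-square error of the scalar filter `w`, when the energies of the signal and of the
noise are `a` and `b` and the two are orthogonal. -/
def filterError (a b : ℝ) (w : ℂ) : ℝ := ‖w - 1‖ ^ 2 * a + ‖w‖ ^ 2 * b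

lemma filterError_eq {a b : ℝ} (hab : a + b ≠ 0) (w : ℂ) :
    filterError a b w = (a + b) * ‖w - (a / (a + b) : ℝ)‖ ^ 2 + a * b / (a + b) := by
  simp only [filterError, ← Complex.normSq_eq_norm_sq, Complex.normSq_apply, Complex.sub_re,
    Complex.sub_im, Complex.one_re, Complex.one_im, Complex.ofReal_re, Complex.ofReal_im]
  field_simp
  ring

lemma filterError_div_self {a b : ℝ} (hab : a + b ≠ 0) :
    filterError a b (a / (a + b) : ℝ) = a * b / (a + b) := by
  rw [filterError_eq hab, sub_self, norm_zero, zero_pow two_ne_zero, mul_zero, zero_add]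

lemma filterError_div_lt {a b : ℝ} (hab : 0 < a + b) {w : ℂ} (hw : w ≠ (a / (a + b) : ℝ)) :
    filterError a b (a / (a + b) : ℝ) < filterError a b w := by
  rw [filterError_div_self hab.ne', filterError_eq hab.ne' w]
  have := norm_pos_iff.2 (sub_ne_zero.2 hw)
  exact lt_add_of_pos_left _ (by positivity)

lemma filterError_div_le {a b : ℝ} (ha : 0 ≤ a) (hb : 0 ≤ b) (w : ℂ) :
    filterError a b (a / (a + b) : ℝ) ≤ filterError a b w := by
  rcases (add_nonneg ha hb).eq_or_lt' with hab | hab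
  · obtain ⟨rfl, rfl⟩ := (add_eq_zero_iff_of_nonneg ha hb).1 hab
    simp [filterError]
  · rcases eq_or_ne w (a / (a + b) : ℝ) with rfl | hw
    · exact le_rfl
    · exact (filterError_div_lt hab hw).le

lemma norm_add_mul_sub_sq (u v w : ℂ) :
    ‖(u + v) * w - u‖ ^ 2 =
      filterError (‖u‖ ^ 2) (‖v‖ ^ 2) w + 2 * ((w - 1) * conj w * (u * conj v)).re := by
  rw [show (u + v) * w - u = (w - 1) * u + w * v by ring, ← Complex.normSq_eq_norm_sq,
    Complex.normSq_add, map_mul, map_mul, map_mul, filterError,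
    show (w - 1) * u * (conj w * conj v) = (w - 1) * conj w * (u * conj v) by ring]
  simp only [Complex.normSq_eq_norm_sq]

variable {Ω : Type*} [MeasurableSpace Ω] {P : Measure Ω} {U V : Ω → ℂ}

lemma integrable_mul_conj (hU : MemLp U 2 P) (hV : MemLp V 2 P) :
    Integrable (fun ω => U ω * conj (V ω)) P :=
  hU.integrable_mul hV.star

lemma ofReal_integral_norm_sq (hU : MemLp U 2 P) :
    ENNReal.ofReal (∫ ω, ‖U ω‖ ^ 2 ∂P) = ∫⁻ ω, ‖U ω‖ₑ ^ 2 ∂P := by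
  simp only [enorm_sq_eq_ofReal]
  exact ofReal_integral_eq_lintegral_ofReal hU.norm.integrable_sq
    (.of_forall fun ω => by positivity)

lemma lintegral_enorm_add_mul_sub_sq (hU : MemLp U 2 P) (hV : MemLp V 2 P)
    (hUV : ∫ ω, U ω * conj (V ω) ∂P = 0) (w : ℂ) :
    ∫⁻ ω, ‖(U ω + V ω) * w - U ω‖ₑ ^ 2 ∂P =
      ENNReal.ofReal (filterError (∫ ω, ‖U ω‖ ^ 2 ∂P) (∫ ω, ‖V ω‖ ^ 2 ∂P) w) := by
  have hU' : Integrable (fun ω => ‖w - 1‖ ^ 2 * ‖U ω‖ ^ 2) P := hU.norm.integrable_sq.const_mul _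
  have hV' : Integrable (fun ω => ‖w‖ ^ 2 * ‖V ω‖ ^ 2) P := hV.norm.integrable_sq.const_mul _
  have hcross := (integrable_mul_conj hU hV).const_mul ((w - 1) * conj w)
  have hcross_re : Integrable (fun ω => 2 * ((w - 1) * conj w * (U ω * conj (V ω))).re) P :=
    hcross.re.const_mul 2
  have integral_cross : ∫ ω, ((w - 1) * conj w * (U ω * conj (V ω))).re ∂P = 0 := by
    rw [show ∫ ω, ((w - 1) * conj w * (U ω * conj (V ω))).re ∂P =
      (∫ ω, (w - 1) * conj w * (U ω * conj (V ω)) ∂P).re from integral_re hcross,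
      integral_const_mul, hUV, mul_zero, Complex.zero_re]
  have herr : MemLp (fun ω => (U ω + V ω) * w - U ω) 2 P := ((hU.add hV).mul_const w).sub hU
  rw [← ofReal_integral_norm_sq herr]
  simp only [norm_add_mul_sub_sq, filterError]
  rw [integral_add (by exact hU'.add hV') hcross_re, integral_add hU' hV', integral_const_mul,
    integral_const_mul, integral_const_mul, integral_cross, mul_zero, add_zero]

end Wiener

/-! ### The mean-square error -/

section MeanSquare

variable {Ω : Type*} [MeasurableSpace Ω]

/-- A random process on the sphere with realisations in `L²` and finite expected energy; its mean
is arbitrary. -/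
structure IsFiniteEnergyProcess (P : Measure Ω) (s : Ω → S2 → ℂ) : Prop where
  memLp : ∀ᵐ ω ∂P, MemLp (s ω) 2 area
  aestronglyMeasurable_coeff : ∀ n, AEStronglyMeasurable (fun ω => coeff (s ω) n) P
  finite_energy : ∫⁻ ω, ∫⁻ x, ‖s ω x‖ₑ ^ 2 ∂area ∂P < ∞

variable {P : Measure Ω} {f s z : Ω → S2 → ℂ} {h : S2 → ℂ} {L : ℕ}

lemma IsZeroMeanProcess.isFiniteEnergyProcess (hs : IsZeroMeanProcess P s) :
    IsFiniteEnergyProcess P s :=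
  ⟨hs.memLp, hs.aestronglyMeasurable_coeff, hs.finite_energy⟩

lemma IsFiniteEnergyProcess.memLp_coeff (hs : IsFiniteEnergyProcess P s) (n : ℕ) :
    MemLp (fun ω => coeff (s ω) n) 2 P := by
  refine ⟨hs.aestronglyMeasurable_coeff n, ?_⟩
  rw [eLpNorm_lt_top_iff_lintegral_rpow_enorm_lt_top two_ne_zero ENNReal.ofNat_ne_top]
  refine (lintegral_mono_ae ?_).trans_lt hs.finite_energy
  filter_upwards [hs.memLp] with ω hω
  simpa using (ENNReal.le_tsum n).trans_eq (tsum_enorm_coeff_sq hω)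

lemma IsFiniteEnergyProcess.memLp_mulYCoeff (hs : IsFiniteEnergyProcess P s) (k n : ℕ) :
    MemLp (fun ω => mulYCoeff k n (coeff (s ω))) 2 P :=
  memLp_finsetSum _ fun c _ => (hs.memLp_coeff c).const_mul _

lemma mulYCoeff_add (k n : ℕ) (a b : ℕ → ℂ) :
    mulYCoeff k n (a + b) = mulYCoeff k n a + mulYCoeff k n b := by
  simp only [mulYCoeff, Pi.add_apply, mul_add, Finset.sum_add_distrib]

lemma mulYCoeff_mul_conj (k n : ℕ) (a b : ℕ → ℂ) :
    mulYCoeff k n a * conj (mulYCoeff k n b) =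
      ∑ c ∈ Finset.range (tripleBound k n), ∑ c' ∈ Finset.range (tripleBound k n),
        T c k n * T c' k n * (a c * conj (b c')) := by
  rw [mulYCoeff, mulYCoeff, map_sum, Finset.sum_mul_sum]
  refine Finset.sum_congr rfl fun c _ => Finset.sum_congr rfl fun c' _ => ?_
  rw [map_mul, conj_T]
  ring

lemma integral_mulYCoeff_mul_conj (hs : IsFiniteEnergyProcess P s)
    (hz : IsFiniteEnergyProcess P z) (k n : ℕ) :
    ∫ ω, mulYCoeff k n (coeff (s ω)) * conj (mulYCoeff k n (coeff (z ω))) ∂P =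
      ∑ c ∈ Finset.range (tripleBound k n), ∑ c' ∈ Finset.range (tripleBound k n),
        T c k n * T c' k n * ∫ ω, coeff (s ω) c * conj (coeff (z ω) c') ∂P := by
  have integrable_term (c c' : ℕ) :=
    (integrable_mul_conj (hs.memLp_coeff c) (hz.memLp_coeff c')).const_mul (T c k n * T c' k n)
  simp only [mulYCoeff_mul_conj]
  rw [integral_finsetSum _ fun c _ => integrable_finsetSum _ fun c' _ => integrable_term c c']
  refine Finset.sum_congr rfl fun c _ => ?_
  rw [integral_finsetSum _ fun c' _ => integrable_term c c']
  simp only [integral_const_mul]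

lemma Uncorrelated.integral_mulYCoeff_mul_conj (hsz : Uncorrelated P s z)
    (hs : IsFiniteEnergyProcess P s) (hz : IsFiniteEnergyProcess P z) (k n : ℕ) :
    ∫ ω, mulYCoeff k n (coeff (s ω)) * conj (mulYCoeff k n (coeff (z ω))) ∂P = 0 := by
  rw [SLSHT.integral_mulYCoeff_mul_conj hs hz]
  exact Finset.sum_eq_zero fun c _ => Finset.sum_eq_zero fun c' _ => by rw [hsz c c', mul_zero]

/-- The mean energy of the `n`-th coefficient of the product of `Y k` with the process `s`. -/
def mulYEnergy (P : Measure Ω) (s : Ω → S2 → ℂ) (k n : ℕ) : ℝ :=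
  ∫ ω, ‖mulYCoeff k n (coeff (s ω))‖ ^ 2 ∂P

lemma mulYEnergy_nonneg (P : Measure Ω) (s : Ω → S2 → ℂ) (k n : ℕ) : 0 ≤ mulYEnergy P s k n :=
  integral_nonneg fun _ => by positivity

/-- The share of the coefficient `(n, r)` in the mean-square error of a filter that takes the
value `w` there. -/
def spectralError (P : Measure Ω) (h : S2 → ℂ) (s z : Ω → S2 → ℂ) (n r : ℕ) (w : ℂ) : ℝ≥0∞ :=
  ‖windowFactor h r‖ₑ ^ 2 * ENNReal.ofReal
    (filterError (mulYEnergy P s (negIdx r) n) (mulYEnergy P z (negIdx r) n) w)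

lemma lintegral_spectralError (hs : IsFiniteEnergyProcess P s) (hz : IsFiniteEnergyProcess P z)
    (hsz : Uncorrelated P s z) (h : S2 → ℂ) (n r : ℕ) (w : ℂ) :
    ∫⁻ ω, ‖windowFactor h r * ((mulYCoeff (negIdx r) n (coeff (s ω)) +
        mulYCoeff (negIdx r) n (coeff (z ω))) * w - mulYCoeff (negIdx r) n (coeff (s ω)))‖ₑ ^ 2 ∂P =
      spectralError P h s z n r w := by
  simp only [enorm_mul, mul_pow]
  rw [lintegral_const_mul' _ _ (by finiteness), lintegral_enorm_add_mul_sub_sq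
    (hs.memLp_mulYCoeff _ _) (hz.memLp_mulYCoeff _ _) (hsz.integral_mulYCoeff_mul_conj hs hz _ _)]
  rfl

lemma coeff_slsht (hsym : IsZonal h) (hb : IsBandLimited L h) {g : S2 → ℂ} (hg : MemLp g 2 area)
    (n : ℕ) {r : ℕ} (hr : r ∈ Finset.range ((L + 1) ^ 2)) :
    coeff (slsht h g n) r = windowFactor h r * mulYCoeff (negIdx r) n (coeff g) := by
  rw [funext (slsht_eq_sum hsym hb hg n),
    coeff_sum_Y _ fun r => windowFactor h r * coeff (Y (negIdx r) * g) n, if_pos hr,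
    coeff_Y_mul hg]

lemma filtered_eq_sum (h g : S2 → ℂ) {ζ : ℕ → S2 → ℂ} (hζ : IsFilter L ζ) (n : ℕ) (y : S2) :
    filtered h g ζ n y =
      ∑ r ∈ Finset.range ((L + 1) ^ 2), coeff (slsht h g n) r * coeff (ζ n) r * Y r y := by
  refine tsum_eq_sum fun r hr => ?_
  rw [Finset.mem_range, ← deg_le_iff, not_le] at hr
  rw [(hζ n).2 r hr, mul_zero, zero_mul]

lemma lintegral_enorm_filtered_sub_slsht_sq (hsym : IsZonal h) (hb : IsBandLimited L h)
    {ζ : ℕ → S2 → ℂ} (hζ : IsFilter L ζ) {u v : S2 → ℂ} (hu : MemLp u 2 area)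
    (hv : MemLp v 2 area) (n : ℕ) :
    ∫⁻ y, ‖filtered h (u + v) ζ n y - slsht h u n y‖ₑ ^ 2 ∂area =
      ∑ r ∈ Finset.range ((L + 1) ^ 2), ‖windowFactor h r *
        ((mulYCoeff (negIdx r) n (coeff u) + mulYCoeff (negIdx r) n (coeff v)) * coeff (ζ n) r
          - mulYCoeff (negIdx r) n (coeff u))‖ₑ ^ 2 := by
  rw [← lintegral_enorm_sum_Y_sq]
  congr! 3 with y
  rw [filtered_eq_sum h _ hζ, slsht_eq_sum hsym hb hu, ← Finset.sum_sub_distrib]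
  refine congrArg _ (Finset.sum_congr rfl fun r hr => ?_)
  rw [coeff_slsht hsym hb (hu.add hv) n hr, coeff_Y_mul hu, ← mulYCoeff_add,
    show coeff (u + v) = coeff u + coeff v from funext (coeff_add hu hv)]
  ring

theorem mse_eq_tsum (hsym : IsZonal h) (hb : IsBandLimited L h)
    (hf : ∀ ω x, f ω x = s ω x + z ω x) (hs : IsFiniteEnergyProcess P s)
    (hz : IsFiniteEnergyProcess P z) (hsz : Uncorrelated P s z) {ζ : ℕ → S2 → ℂ}
    (hζ : IsFilter L ζ) :
    mse P h f s ζ =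
      ∑' i : ℕ × Fin ((L + 1) ^ 2), spectralError P h s z i.1 i.2 (coeff (ζ i.1) i.2) := by
  let err (n r : ℕ) (ω : Ω) : ℝ≥0∞ := ‖windowFactor h r *
    ((mulYCoeff (negIdx r) n (coeff (s ω)) + mulYCoeff (negIdx r) n (coeff (z ω))) *
      coeff (ζ n) r - mulYCoeff (negIdx r) n (coeff (s ω)))‖ₑ ^ 2
  have aemeasurable_err (n r : ℕ) : AEMeasurable (err n r) P := by
    have hA := (hs.memLp_mulYCoeff (negIdx r) n).aestronglyMeasurable
    have hB := (hz.memLp_mulYCoeff (negIdx r) n).aestronglyMeasurable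
    exact ((((hA.add hB).mul_const _).sub hA).const_mul _).enorm.pow_const 2
  calc mse P h f s ζ
      = ∫⁻ ω, ∑' n, ∑ r ∈ Finset.range ((L + 1) ^ 2), err n r ω ∂P := by
        refine lintegral_congr_ae ?_
        filter_upwards [hs.memLp, hz.memLp] with ω hsω hzω
        rw [show f ω = s ω + z ω from funext (hf ω)]
        exact tsum_congr fun n =>
          lintegral_enorm_filtered_sub_slsht_sq hsym hb hζ hsω hzω n
    _ = ∑' n, ∑ r ∈ Finset.range ((L + 1) ^ 2), ∫⁻ ω, err n r ω ∂P := by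
        rw [lintegral_tsum fun n => Finset.aemeasurable_fun_sum _ fun r _ => aemeasurable_err n r]
        exact tsum_congr fun n => lintegral_finsetSum' _ fun r _ => aemeasurable_err n r
    _ = ∑' i : ℕ × Fin ((L + 1) ^ 2), spectralError P h s z i.1 i.2 (coeff (ζ i.1) i.2) := by
        simp only [err, lintegral_spectralError hs hz hsz]
        rw [ENNReal.tsum_prod']
        exact tsum_congr fun n => by
          rw [tsum_fintype, Fin.sum_univ_eq_sum_range
            (fun r => spectralError P h s z n r (coeff (ζ n) r))]

lemma tsum_enorm_mulYCoeff_sq_le {g : S2 → ℂ} (hg : MemLp g 2 area) {k : ℕ} {M : ℝ}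
    (hM : ∀ x, ‖Y k x‖ ≤ M) :
    ∑' n, ‖mulYCoeff k n (coeff g)‖ₑ ^ 2 ≤
      ENNReal.ofReal M ^ 2 * ∫⁻ x, ‖g x‖ₑ ^ 2 ∂area := by
  simp only [← coeff_Y_mul hg]
  rw [tsum_enorm_coeff_sq (memLp_Y_mul hg k), ← lintegral_const_mul' _ _ (by finiteness)]
  refine lintegral_mono fun x => ?_
  rw [Pi.mul_apply, enorm_mul, mul_pow]
  gcongr
  rw [← ofReal_norm]
  exact ENNReal.ofReal_le_ofReal (hM x)

lemma IsFiniteEnergyProcess.tsum_mulYEnergy_lt_top (hs : IsFiniteEnergyProcess P s) (k : ℕ) :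
    ∑' n, ENNReal.ofReal (mulYEnergy P s k n) < ∞ := by
  obtain ⟨M, hM⟩ := isCompact_univ.exists_bound_of_continuousOn (continuous_Y k).continuousOn
  simp only [mulYEnergy, ofReal_integral_norm_sq (hs.memLp_mulYCoeff k _)]
  rw [← lintegral_tsum fun n => (hs.memLp_mulYCoeff k n).aestronglyMeasurable.enorm.pow_const 2]
  calc ∫⁻ ω, ∑' n, ‖mulYCoeff k n (coeff (s ω))‖ₑ ^ 2 ∂P
      ≤ ∫⁻ ω, ENNReal.ofReal M ^ 2 * ∫⁻ x, ‖s ω x‖ₑ ^ 2 ∂area ∂P := by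
        refine lintegral_mono_ae ?_
        filter_upwards [hs.memLp] with ω hω
        exact tsum_enorm_mulYCoeff_sq_le hω fun x => hM x trivial
    _ = ENNReal.ofReal M ^ 2 * ∫⁻ ω, ∫⁻ x, ‖s ω x‖ₑ ^ 2 ∂area ∂P :=
        lintegral_const_mul' _ _ (by finiteness)
    _ < ∞ := ENNReal.mul_lt_top (by finiteness) hs.finite_energy

lemma tsum_spectralError_zero_lt_top (hs : IsFiniteEnergyProcess P s) (h : S2 → ℂ)
    (z : Ω → S2 → ℂ) (N : ℕ) :
    ∑' i : ℕ × Fin N, spectralError P h s z i.1 i.2 0 < ∞ := by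
  rw [ENNReal.tsum_prod', ENNReal.tsum_comm, tsum_fintype, ENNReal.sum_lt_top]
  intro r _
  simp only [spectralError, filterError, zero_sub, norm_neg, norm_one, one_pow, one_mul,
    norm_zero, zero_pow two_ne_zero, zero_mul, add_zero]
  rw [ENNReal.tsum_mul_left]
  exact ENNReal.mul_lt_top (by finiteness) (hs.tsum_mulYEnergy_lt_top _)

end MeanSquare

/-! ### The optimal filter -/

section OptimalFilter

variable {Ω : Type*} [MeasurableSpace Ω] {P : Measure Ω} {f s z : Ω → S2 → ℂ} {h : S2 → ℂ} {L : ℕ}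

lemma quadSum_eq_sum (h : S2 → ℂ) (C : ℕ → ℕ → ℂ) (r n : ℕ) :
    quadSum h C r n = windowFactor h r ^ 2 *
      ∑ c ∈ Finset.range (tripleBound (negIdx r) n),
        ∑ c' ∈ Finset.range (tripleBound (negIdx r) n),
          T c (negIdx r) n * T c' (negIdx r) n * C c c' := by
  have H_eq_zero : ∀ c ∉ Finset.range (tripleBound (negIdx r) n), H h c r n = 0 := fun c hc => by
    rw [H_eq, T_eq_zero (by simpa using hc), mul_zero]
  rw [quadSum, tsum_eq_sum fun c hc => by simp only [H_eq_zero c hc, zero_mul, tsum_zero],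
    Finset.mul_sum]
  refine Finset.sum_congr rfl fun c _ => ?_
  rw [tsum_eq_sum fun c' hc' => by rw [H_eq_zero c' hc', mul_zero, zero_mul], Finset.mul_sum]
  refine Finset.sum_congr rfl fun c' _ => ?_
  rw [H_eq, H_eq]
  ring

lemma quadSum_add (h : S2 → ℂ) (C C' : ℕ → ℕ → ℂ) (r n : ℕ) :
    quadSum h (fun c c' => C c c' + C' c c') r n = quadSum h C r n + quadSum h C' r n := by
  simp only [quadSum_eq_sum, mul_add, Finset.sum_add_distrib]

lemma quadSum_specCov (hs : IsFiniteEnergyProcess P s) (h : S2 → ℂ) (r n : ℕ) :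
    quadSum h (specCov P s) r n = windowFactor h r ^ 2 * (mulYEnergy P s (negIdx r) n : ℂ) := by
  rw [quadSum_eq_sum, mulYEnergy, ← integral_complex_ofReal]
  simp only [specCov, ← integral_mulYCoeff_mul_conj hs hs, Complex.mul_conj', Complex.ofReal_pow]

/-- The coefficients of the optimal filter. They are `0` where the denominator vanishes, because
`x / 0 = 0`. -/
def optCoeff (P : Measure Ω) (h : S2 → ℂ) (s z : Ω → S2 → ℂ) (n r : ℕ) : ℂ :=
  quadSum h (specCov P s) r n / quadSum h (fun c c' => specCov P s c c' + specCov P z c c') r n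

lemma optCoeff_eq (hs : IsFiniteEnergyProcess P s) (hz : IsFiniteEnergyProcess P z) {r : ℕ}
    (hr : windowFactor h r ≠ 0) (n : ℕ) :
    optCoeff P h s z n r = (mulYEnergy P s (negIdx r) n /
      (mulYEnergy P s (negIdx r) n + mulYEnergy P z (negIdx r) n) : ℝ) := by
  rw [optCoeff, quadSum_add, quadSum_specCov hs, quadSum_specCov hz, ← mul_add,
    mul_div_mul_left _ _ (pow_ne_zero 2 hr), Complex.ofReal_div, Complex.ofReal_add]

lemma spectralError_optCoeff_le (hs : IsFiniteEnergyProcess P s) (hz : IsFiniteEnergyProcess P z)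
    (h : S2 → ℂ) (n r : ℕ) (w : ℂ) :
    spectralError P h s z n r (optCoeff P h s z n r) ≤ spectralError P h s z n r w := by
  by_cases hr : windowFactor h r = 0
  · simp [spectralError, hr]
  · rw [spectralError, optCoeff_eq hs hz hr]
    exact mul_le_mul_right (ENNReal.ofReal_le_ofReal (filterError_div_le (mulYEnergy_nonneg P s _ _)
      (mulYEnergy_nonneg P z _ _) w)) _

lemma spectralError_optCoeff_lt (hs : IsFiniteEnergyProcess P s) (hz : IsFiniteEnergyProcess P z)
    {n r : ℕ} {w : ℂ}
    (hq : quadSum h (fun c c' => specCov P s c c' + specCov P z c c') r n ≠ 0)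
    (hw : w ≠ optCoeff P h s z n r) :
    spectralError P h s z n r (optCoeff P h s z n r) < spectralError P h s z n r w := by
  rw [quadSum_add, quadSum_specCov hs, quadSum_specCov hz, ← mul_add, ← Complex.ofReal_add] at hq
  have hr : windowFactor h r ≠ 0 := pow_ne_zero_iff two_ne_zero |>.1 (left_ne_zero_of_mul hq)
  have ha := mulYEnergy_nonneg P s (negIdx r) n
  have hb := mulYEnergy_nonneg P z (negIdx r) n
  have hab : 0 < mulYEnergy P s (negIdx r) n + mulYEnergy P z (negIdx r) n :=
    (add_nonneg ha hb).lt_of_ne' (Complex.ofReal_ne_zero.1 (right_ne_zero_of_mul hq))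
  rw [optCoeff_eq hs hz hr] at hw ⊢
  have hlt := filterError_div_lt hab hw
  refine ENNReal.mul_lt_mul_right (pow_ne_zero 2 (enorm_ne_zero.2 hr)) (by finiteness)
    ((ENNReal.ofReal_lt_ofReal_iff (lt_of_le_of_lt ?_ hlt)).2 hlt)
  rw [filterError_div_self hab.ne']
  positivity

lemma exists_isFilter_coeff_eq (L : ℕ) (c : ℕ → ℕ → ℂ) :
    ∃ ζ, IsFilter L ζ ∧ ∀ n, ∀ r < (L + 1) ^ 2, coeff (ζ n) r = c n r := by
  refine ⟨fun n x => ∑ r ∈ Finset.range ((L + 1) ^ 2), c n r * Y r x, fun n =>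
    ⟨memLp_sum_Y _ _, fun r hr => ?_⟩, fun n r hr => ?_⟩
  · rw [coeff_sum_Y, if_neg]
    rwa [Finset.mem_range, ← deg_le_iff, not_le]
  · rw [coeff_sum_Y, if_pos (Finset.mem_range.2 hr)]

lemma isOptimalFilter_of_coeff_eq (hsym : IsZonal h) (hb : IsBandLimited L h)
    (hf : ∀ ω x, f ω x = s ω x + z ω x) (hs : IsFiniteEnergyProcess P s)
    (hz : IsFiniteEnergyProcess P z) (hsz : Uncorrelated P s z) {ζ : ℕ → S2 → ℂ}
    (hζ : IsFilter L ζ) (hc : ∀ n, ∀ r < (L + 1) ^ 2, coeff (ζ n) r = optCoeff P h s z n r) :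
    IsOptimalFilter P L h f s ζ := by
  refine ⟨hζ, fun ξ hξ => ?_⟩
  rw [mse_eq_tsum hsym hb hf hs hz hsz hζ, mse_eq_tsum hsym hb hf hs hz hsz hξ]
  refine ENNReal.tsum_le_tsum fun i => ?_
  rw [hc i.1 i.2 i.2.2]
  exact spectralError_optCoeff_le hs hz h _ _ _

lemma coeff_eq_of_isOptimalFilter (hsym : IsZonal h) (hb : IsBandLimited L h)
    (hf : ∀ ω x, f ω x = s ω x + z ω x) (hs : IsFiniteEnergyProcess P s)
    (hz : IsFiniteEnergyProcess P z) (hsz : Uncorrelated P s z) {ζ : ℕ → S2 → ℂ}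
    (hζ : IsOptimalFilter P L h f s ζ) {n r : ℕ} (hr : r < (L + 1) ^ 2)
    (hq : quadSum h (fun c c' => specCov P s c c' + specCov P z c c') r n ≠ 0) :
    coeff (ζ n) r = optCoeff P h s z n r := by
  by_contra hne
  obtain ⟨ξ, hξ, hc⟩ := exists_isFilter_coeff_eq L (optCoeff P h s z)
  have le_all (i : ℕ × Fin ((L + 1) ^ 2)) (w : ℂ) :
      spectralError P h s z i.1 i.2 (coeff (ξ i.1) i.2) ≤ spectralError P h s z i.1 i.2 w := by
    rw [hc i.1 i.2 i.2.2]
    exact spectralError_optCoeff_le hs hz h _ _ _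
  have finite_sum : ∑' i : ℕ × Fin ((L + 1) ^ 2),
      spectralError P h s z i.1 i.2 (coeff (ξ i.1) i.2) ≠ ∞ :=
    ((ENNReal.tsum_le_tsum fun i => le_all i 0).trans_lt
      (tsum_spectralError_zero_lt_top hs h z _)).ne
  have strict_gain : spectralError P h s z n r (coeff (ξ n) r) <
      spectralError P h s z n r (coeff (ζ n) r) := by
    rw [hc n r hr]
    exact spectralError_optCoeff_lt hs hz hq hne
  refine (hζ.2 ξ hξ).not_gt ?_
  rw [mse_eq_tsum hsym hb hf hs hz hsz hζ.1, mse_eq_tsum hsym hb hf hs hz hsz hξ]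
  exact ENNReal.tsum_lt_tsum (i := (n, ⟨r, hr⟩)) finite_sum (fun i => le_all i _) strict_gain

end OptimalFilter

end SLSHT

end

theorem theorem1_general {Ω : Type*} [MeasurableSpace Ω] (P : Measure Ω)
    (L : ℕ) (h : SLSHT.S2 → ℂ) (hb : SLSHT.IsBandLimited L h) (hsym : SLSHT.IsZonal h)
    (f s z : Ω → SLSHT.S2 → ℂ)
    (hf : ∀ ω x, f ω x = s ω x + z ω x)
    (hs : SLSHT.IsFiniteEnergyProcess P s) (hz : SLSHT.IsFiniteEnergyProcess P z)
    (hsz : SLSHT.Uncorrelated P s z)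
    (CS CZ : ℕ → ℕ → ℂ) (hCS : CS = SLSHT.specCov P s) (hCZ : CZ = SLSHT.specCov P z)
    (opt : ℕ → ℕ → ℂ)
    (hopt : ∀ n r, opt n r =
      if SLSHT.quadSum h (fun c c' => CS c c' + CZ c c') r n = 0 then 0
      else SLSHT.quadSum h CS r n / SLSHT.quadSum h (fun c c' => CS c c' + CZ c c') r n) :
    (∃ ζ, SLSHT.IsFilter L ζ ∧ ∀ n, ∀ r ≤ L ^ 2 + 2 * L, SLSHT.coeff (ζ n) r = opt n r) ∧
    (∀ ζ, SLSHT.IsFilter L ζ →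
      (∀ n, ∀ r ≤ L ^ 2 + 2 * L, SLSHT.coeff (ζ n) r = opt n r) →
      SLSHT.IsOptimalFilter P L h f s ζ) ∧
    (∀ ζ, SLSHT.IsOptimalFilter P L h f s ζ → ∀ n, ∀ r ≤ L ^ 2 + 2 * L,
      SLSHT.quadSum h (fun c c' => CS c c' + CZ c c') r n ≠ 0 →
      SLSHT.coeff (ζ n) r = opt n r) := by
  subst hCS hCZ
  have le_iff_lt_sq (r : ℕ) : r ≤ L ^ 2 + 2 * L ↔ r < (L + 1) ^ 2 := by
    rw [show (L + 1) ^ 2 = L ^ 2 + 2 * L + 1 by ring, Nat.lt_succ_iff]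
  have opt_eq (n r : ℕ) : opt n r = SLSHT.optCoeff P h s z n r := by
    rw [hopt, SLSHT.optCoeff]
    split_ifs with hq
    · rw [hq, div_zero]
    · rfl
  simp only [le_iff_lt_sq, opt_eq]
  exact ⟨SLSHT.exists_isFilter_coeff_eq L _,
    fun _ => SLSHT.isOptimalFilter_of_coeff_eq hsym hb hf hs hz hsz,
    fun _ hζ _ _ => SLSHT.coeff_eq_of_isOptimalFilter hsym hb hf hs hz hsz hζ⟩

theorem theorem1 {Ω : Type*} [MeasurableSpace Ω] (P : Measure Ω) [IsProbabilityMeasure P]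
    (L : ℕ) (h : SLSHT.S2 → ℂ) (hh : SLSHT.IsWindow L h)
    (f s z : Ω → SLSHT.S2 → ℂ)
    (hf : ∀ ω x, f ω x = s ω x + z ω x)
    (hs : SLSHT.IsZeroMeanProcess P s) (hz : SLSHT.IsZeroMeanProcess P z)
    (hsz : SLSHT.Uncorrelated P s z)
    (CS CZ : ℕ → ℕ → ℂ) (hCS : CS = SLSHT.specCov P s) (hCZ : CZ = SLSHT.specCov P z)
    (opt : ℕ → ℕ → ℂ)
    (hopt : ∀ n r, opt n r =
      if SLSHT.quadSum h (fun c c' => CS c c' + CZ c c') r n = 0 then 0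
      else SLSHT.quadSum h CS r n / SLSHT.quadSum h (fun c c' => CS c c' + CZ c c') r n) :
    -- there is an admissible filter with the prescribed coefficients
    (∃ ζ, SLSHT.IsFilter L ζ ∧ ∀ n, ∀ r ≤ L ^ 2 + 2 * L, SLSHT.coeff (ζ n) r = opt n r) ∧
    -- every such filter minimises the mean-square error
    (∀ ζ, SLSHT.IsFilter L ζ →
      (∀ n, ∀ r ≤ L ^ 2 + 2 * L, SLSHT.coeff (ζ n) r = opt n r) →
      SLSHT.IsOptimalFilter P L h f s ζ) ∧
    -- every minimiser has these coefficients wherever the denominator does not vanish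
    (∀ ζ, SLSHT.IsOptimalFilter P L h f s ζ → ∀ n, ∀ r ≤ L ^ 2 + 2 * L,
      SLSHT.quadSum h (fun c c' => CS c c' + CZ c c') r n ≠ 0 →
      SLSHT.coeff (ζ n) r = opt n r) := by
  exact theorem1_general P L h hh.bandLimited hh.symmetric f s z hf hs.isFiniteEnergyProcess
    hz.isFiniteEnergyProcess hsz CS CZ hCS hCZ opt hopt
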